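/- **Setting.** Let $B=(E,L,R,\lambda,\rho_B)$ be a finite bipartite graph with bit nodes $L$, check nodes $R$ and edges $E$, each $e\in E$ joining $\lambda(e)\in L$ to $\rho_B(e)\in R$ (parallel edges allowed). Assume that $B$ is connected, that every check node has degree $2$, that every bit node has degree at least $2$, and that some bit node has degree at least $3$. For $e\in E$ let $\bar e$ be the other edge at the check node of $e$. Given inputs $u_\ell\in(0,\infty)$, $\ell\in L$, the sum-product algorithm (SPA) sets $y_e^{(0)}=1$ and, for $t\ge 1$, $$x_e^{(t)}=u_{\lambda(e)}\prod_{\substack{f:\lambda(f)=\lambda(e)\\ f\ne e}}y_f^{(t-1)},\qquad y_e^{(t)}=s\Big(\prod_{\substack{f:\rho_B(f)=\rho_B(e)\\ f\neq e}}s(x_f^{(t)})\Big),\qquad \hat u_\ell^{(t)}=u_\ell\prod_{e:\lambda(e)=\ell}y_e^{(t)},$$ where $s(x)=\frac{1-x}{1+x}$. The SPA *converges* if all messages $x_e^{(t)}$ and all estimates $\hat u_\ell^{(t)}$ tend to $0$ as $t\to\infty$, or all of them tend to $\infty$. The flow graph $\widetilde G$ is the directed graph with vertex set $E$ and an edge from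 $e$ to $f$ whenever $\lambda(\bar e)=\lambda(f)$ and $\bar f\ne e$. Let $\mathbf K$ be the $E\times E$ matrix with $\mathbf K_{e,f}=1$ if $\lambda(\bar f)=\lambda(e)$ and $\bar f\neq e$ (that is, if $\widetilde G$ has an edge from $f$ to $e$), and $\mathbf K_{e,f}=0$ otherwise. (Under these assumptions $\mathbf K$ is irreducible.) Let $\rho$ be the Perron root of $\mathbf K$ (its positive eigenvalue of maximum modulus), and let $h$ be the index of imprimitivity of $\mathbf K$ (the greatest common divisor of the lengths of the cycles of $\widetilde G$). Let $E=E_1\sqcup\dots\sqcup E_h$ be a partition such that every edge of $\widetilde G$ goes from $E_{i+1}$ to $E_i$ for some $1\le i<h$ or from $E_1$ to $E_h$. Let $\mathbf K_i$ be the block of $\mathbf K$ with rows in $E_i$ and columns in $E_{i+1}$ (indices mod $h$). Let $y_1^\ast,z_1$ be positive left and right eigenvectors of $\mathbf K_1\mathbf K_2\cdots\mathbf K_h$ for the eigenvalue $\rho^h$ with $y_1^\ast z_1=1$, and for $1\le j\le h$ put $$y_j^\ast=\rho^{1-j}y_1^\ast\mathbf K_1\cdots\mathbf K_{j-1},\qquad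 z_j=\rho^{j-h-1}\mathbf K_j\mathbf K_{j+1}\cdots\mathbf K_h z_1 .$$ For $e\in E_j$ write $z_e$ for the entry of $z_j$ at $e$. For $i\in\{1,\dots,h\}$ let $c_i\in\mathbb R^L$ be the vector whose $\ell$-th entry is the sum of the entries of $y_i^\ast$ at the edges $e\in E_i$ with $\lambda(e)=\ell$; the index of $c_i$ is read modulo $h$. For $c\in\mathbb R^L$ write $u^{c}=\prod_{\ell\in L}u_\ell^{c_\ell}$. **Theorem 4.3.** For $r\in\{0,\dots,h-1\}$, $1\le i\le h$ and $e\in E_i$, $$\lim_{q\to\infty}\left(x_e^{(hq+r)}\right)^{\frac{1}{\rho^r}\cdot\frac{\rho^h-1}{\rho^{hq}-1}}=\Big(\prod_{j=0}^{h-1}\big(u^{c_{r+i+j}}\big)^{\rho^j}\Big)^{z_e}.$$ The SPA converges if and only if the products $$U_r=\prod_{j=0}^{h-1}\big(u^{c_{r+j}}\big)^{\rho^j},\qquad r=0,\dots,h-1,$$ all have the same parity, that is, if and only if $U_r<1$ for all $r$ or $U_r>1$ for all $r$. If no $U_r$ equals $1$, the same condition is also necessary and sufficient for the estimates alone to converge,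 that is, for all $\hat u_\ell^{(t)}$ to tend to $0$ or all to tend to $\infty$. -/

import Mathlib

open Filter Topology Finset

noncomputable section

namespace SPA

/-- A directed graph with vertex set `V` and edge set `A`; loops and parallel edges are allowed. -/
structure DirGraph (V A : Type*) where
  src : A → V
  tgt : A → V

namespace DirGraph

variable {V A : Type*}

/-- The undirected graph obtained by adding a reversed copy of every edge. -/
def symm (G : DirGraph V A) : DirGraph V (A ⊕ A) where
  src := Sum.elim G.src G.tgt
  tgt := Sum.elim G.tgt G.src

/-- Any vertex can be reached from any vertex by a path (of length zero only from a vertex to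
itself). -/
def Connected (G : DirGraph V A) : Prop :=
  ∀ v w : V, Relation.ReflTransGen (fun a b => ∃ e, G.src e = a ∧ G.tgt e = b) v w

/-- The lengths of the cycles `e₀ ∘ e₁ ∘ ⋯ ∘ eₙ₋₁`, that is, of the paths of positive length that
end where they start. -/
def cycleLengths (G : DirGraph V A) : Set ℕ :=
  {n | 0 < n ∧ ∃ w : ℕ → A,
    (∀ i, i + 1 < n → G.tgt (w i) = G.src (w (i + 1))) ∧ G.tgt (w (n - 1)) = G.src (w 0)}

end DirGraph

/-- A bipartite graph with edge set `E`, bit nodes `L` (on the left) and check nodes `R` (on the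
right): the edge `e` goes from `lam e` to `rho e`.  Parallel edges are allowed. -/
structure BipGraph (E L R : Type*) where
  lam : E → L
  rho : E → R

namespace BipGraph

variable {E L R : Type*}

/-- The bipartite graph as a directed graph. -/
def toDirGraph (B : BipGraph E L R) : DirGraph (L ⊕ R) E where
  src := fun e => Sum.inl (B.lam e)
  tgt := fun e => Sum.inr (B.rho e)

/-- The degree of a bit node. -/
def bitDegree [Fintype E] [DecidableEq L] (B : BipGraph E L R) (l : L) : ℕ :=
  (univ.filter fun e => B.lam e = l).card

/-- The degree of a check node. -/
def checkDegree [Fintype E] [DecidableEq R] (B : BipGraph E L R) (c : R) : ℕ :=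
  (univ.filter fun e => B.rho e = c).card

/-! ### The sum-product algorithm, in odds-ratio form -/

/-- The transform between the odds domain and the difference domain. -/
def sTransform (x : ℝ) : ℝ := (1 - x) / (1 + x)

section algorithm

variable [Fintype E] [DecidableEq E] [DecidableEq L] [DecidableEq R]

/-- The bit-to-check step. -/
def bitToCheck (B : BipGraph E L R) (u : L → ℝ) (y : E → ℝ) (e : E) : ℝ :=
  u (B.lam e) * ∏ f ∈ univ.filter (fun f => B.lam f = B.lam e ∧ f ≠ e), y f

/-- The check-to-bit step. -/
def checkToBit (B : BipGraph E L R) (x : E → ℝ) (e : E) : ℝ :=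
  sTransform (∏ f ∈ univ.filter (fun f => B.rho f = B.rho e ∧ f ≠ e), sTransform (x f))

/-- The check-to-bit messages `y_e^{(t)}`. -/
def yMsg (B : BipGraph E L R) (u : L → ℝ) : ℕ → E → ℝ
  | 0 => fun _ => 1
  | t + 1 => B.checkToBit (B.bitToCheck u (yMsg B u t))

/-- The bit-to-check messages `x_e^{(t)}`.  The algorithm produces them for `t ≥ 1`; the value at
`t = 0` is set to `1`. -/
def xMsg (B : BipGraph E L R) (u : L → ℝ) : ℕ → E → ℝ
  | 0 => fun _ => 1
  | t + 1 => B.bitToCheck u (B.yMsg u t)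

/-- The new estimates `û_ℓ^{(t)}`. -/
def estimate (B : BipGraph E L R) (u : L → ℝ) (t : ℕ) (l : L) : ℝ :=
  u l * ∏ e ∈ univ.filter (fun e => B.lam e = l), B.yMsg u t e

/-- All estimates tend to `0`, or all estimates tend to `∞`. -/
def EstimatesConverge (B : BipGraph E L R) (u : L → ℝ) : Prop :=
  (∀ l, Tendsto (fun t => B.estimate u t l) atTop (𝓝 0)) ∨
    (∀ l, Tendsto (fun t => B.estimate u t l) atTop atTop)

/-- The sum-product algorithm converges to `0`: all edge messages and all estimates do. -/
def ConvergesToZero (B : BipGraph E L R) (u : L → ℝ) : Prop :=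
  (∀ e, Tendsto (fun t => B.xMsg u t e) atTop (𝓝 0)) ∧
    (∀ l, Tendsto (fun t => B.estimate u t l) atTop (𝓝 0))

/-- The sum-product algorithm converges to `∞`: all edge messages and all estimates do. -/
def ConvergesToInfty (B : BipGraph E L R) (u : L → ℝ) : Prop :=
  (∀ e, Tendsto (fun t => B.xMsg u t e) atTop atTop) ∧
    (∀ l, Tendsto (fun t => B.estimate u t l) atTop atTop)

/-- The sum-product algorithm converges (to one of the two codewords). -/
def Converges (B : BipGraph E L R) (u : L → ℝ) : Prop :=
  B.ConvergesToZero u ∨ B.ConvergesToInfty u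

end algorithm

/-! ### The associated undirected graph, the flow graph and the flow matrix -/

open Classical in
/-- The conjugate of `e`: the unique other edge at the same check node.  (The value is `e` itself
if there is no such unique edge, which does not happen when all check nodes have degree `2`.) -/
def conj (B : BipGraph E L R) (e : E) : E :=
  if h : ∃! f, f ≠ e ∧ B.rho f = B.rho e then h.choose else e

/-- The graph on the bit nodes obtained by treating the two edges at a check node as a conjugate
pair: `e` runs from `λ(e)` to `λ(ē)`. -/
def assocGraph (B : BipGraph E L R) : DirGraph L E where
  src := B.lam
  tgt := fun e => B.lam (B.conj e)

/-- The flow graph: its vertices are the edges of the associated graph `G`, and it has an edge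
from `e` to `f` when `f` can follow `e` in `G` without backtracking. -/
def flowGraph (B : BipGraph E L R) :
    DirGraph E {p : E × E // B.assocGraph.tgt p.1 = B.assocGraph.src p.2 ∧ B.conj p.2 ≠ p.1} where
  src := fun p => p.1.1
  tgt := fun p => p.1.2

/-- The edge-vertex matrix `Λ`. -/
def Lam [DecidableEq L] (B : BipGraph E L R) : Matrix E L ℝ :=
  Matrix.of fun e l => if B.lam e = l then 1 else 0

/-- The flow matrix `K` of the local sum algorithm; `K e f = 1` exactly when the flow graph has an
edge from `f` to `e`. -/
def K [DecidableEq E] [DecidableEq L] (B : BipGraph E L R) : Matrix E E ℝ :=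
  Matrix.of fun e f => if B.lam (B.conj f) = B.lam e ∧ B.conj f ≠ e then 1 else 0

/-- `h` is the index of imprimitivity: the greatest common divisor of the lengths of the cycles in
the flow graph. -/
def IsImprimitivityIndex (B : BipGraph E L R) (h : ℕ) : Prop :=
  IsGreatest {d : ℕ | ∀ n ∈ B.flowGraph.cycleLengths, d ∣ n} h

/-- `cls` describes a partition of `E` into `E₁, …, E_h` (with `E_i` the set of `e` such that
`cls e = i`) such that every edge of the flow graph goes from `E_{i+1}` to `E_i` for some `i < h`
or from `E₁` to `E_h`. -/
def IsCyclicPartition (B : BipGraph E L R) (h : ℕ) (cls : E → ℕ) : Prop :=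
  (∀ e, 1 ≤ cls e ∧ cls e ≤ h) ∧
    ∀ a, cls (B.flowGraph.src a) ≡ cls (B.flowGraph.tgt a) + 1 [MOD h]

end BipGraph

/-! ### Perron root and Perron vectors -/

section perron

variable {E : Type*} [Fintype E] [DecidableEq E]

/-- `ρ` is a positive eigenvalue of the real matrix `M` of maximum modulus among its complex
eigenvalues. -/
def IsPerronRoot (M : Matrix E E ℝ) (ρ : ℝ) : Prop :=
  0 < ρ ∧ Module.End.HasEigenvalue (Matrix.toLin' M) ρ ∧
    ∀ μ : ℂ, Module.End.HasEigenvalue (Matrix.toLin' (M.map (fun a : ℝ => (a : ℂ)))) μ → ‖μ‖ ≤ ρ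

/-- The block `K_i` of `M`, with rows in `E_i` and columns in `E_{i+1}` (indices modulo `h`),
extended by zero to an `E × E` matrix. -/
def block (M : Matrix E E ℝ) (h : ℕ) (cls : E → ℕ) (i : ℕ) : Matrix E E ℝ :=
  Matrix.of fun e f => if cls e ≡ i [MOD h] ∧ cls f ≡ i + 1 [MOD h] then M e f else 0

/-- The product `K_i K_{i+1} ⋯ K_{i+n-1}` of `n` consecutive blocks. -/
def blockProd (M : Matrix E E ℝ) (h : ℕ) (cls : E → ℕ) : ℕ → ℕ → Matrix E E ℝ
  | _, 0 => 1
  | i, n + 1 => block M h cls i * blockProd M h cls (i + 1) n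

/-- `y₁` and `z₁` (vectors indexed by `E₁`, extended by zero to `E`) are left and right Perron
vectors of `K₁ K₂ ⋯ K_h`, whose Perron root is `ρ ^ h`, and `y₁ z₁ = 1`. -/
structure IsPerronPair (M : Matrix E E ℝ) (ρ : ℝ) (h : ℕ) (cls : E → ℕ) (y₁ z₁ : E → ℝ) :
    Prop where
  y_pos : ∀ e, cls e = 1 → 0 < y₁ e
  z_pos : ∀ e, cls e = 1 → 0 < z₁ e
  y_zero : ∀ e, cls e ≠ 1 → y₁ e = 0
  z_zero : ∀ e, cls e ≠ 1 → z₁ e = 0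
  y_eigen : Matrix.vecMul y₁ (blockProd M h cls 1 h) = ρ ^ h • y₁
  z_eigen : Matrix.mulVec (blockProd M h cls 1 h) z₁ = ρ ^ h • z₁
  normalized : y₁ ⬝ᵥ z₁ = 1

/-- The entry at `e ∈ E_j` of `y_j = ρ^{1-j} y₁ K₁ K₂ ⋯ K_{j-1}`. -/
def yVec (M : Matrix E E ℝ) (ρ : ℝ) (h : ℕ) (cls : E → ℕ) (y₁ : E → ℝ) (e : E) : ℝ :=
  ρ ^ (1 - (cls e : ℤ)) * Matrix.vecMul y₁ (blockProd M h cls 1 (cls e - 1)) e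

/-- The entry at `e ∈ E_j` of `z_j = ρ^{j-h-1} K_j K_{j+1} ⋯ K_h z₁`. -/
def zVec (M : Matrix E E ℝ) (ρ : ℝ) (h : ℕ) (cls : E → ℕ) (z₁ : E → ℝ) (e : E) : ℝ :=
  ρ ^ ((cls e : ℤ) - h - 1) * Matrix.mulVec (blockProd M h cls (cls e) (h + 1 - cls e)) z₁ e

end perron

/-! ### The exponent vectors and the products `U_r` -/

/-- `u^a = ∏_ℓ u_ℓ ^ a_ℓ`. -/
def monomial {L : Type*} [Fintype L] (u a : L → ℝ) : ℝ := ∏ l, u l ^ a l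

section products

variable {E L R : Type*} [Fintype E] [DecidableEq E] [DecidableEq L]

/-- `c_i = y_i Λ_i`, where `Λ_i` consists of the rows of `Λ` in `E_i`; the index `i` is read
modulo `h`. -/
def cVec (B : BipGraph E L R) (ρ : ℝ) (h : ℕ) (cls : E → ℕ) (y₁ : E → ℝ) (i : ℕ) (l : L) : ℝ :=
  ∑ e ∈ univ.filter (fun e => cls e ≡ i [MOD h]), yVec B.K ρ h cls y₁ e * B.Lam e l

/-- `U_r = ∏_{j=0}^{h-1} (u^{c_{r+j}})^{ρ^j}`. -/
def U [Fintype L] (B : BipGraph E L R) (ρ : ℝ) (h : ℕ) (cls : E → ℕ) (y₁ : E → ℝ) (u : L → ℝ)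
    (r : ℕ) : ℝ :=
  ∏ j ∈ range h, monomial u (cVec B ρ h cls y₁ (r + j)) ^ (ρ ^ j)

end products

/-- The numbers `w 0, …, w (h-1)` have the same parity, where a positive number has parity `0` if
it is less than `1`, parity `∞` if it is greater than `1`, and no parity if it equals `1`. -/
def SameParity (h : ℕ) (w : ℕ → ℝ) : Prop :=
  (∀ r < h, w r < 1) ∨ (∀ r < h, 1 < w r)

end SPA

end

/-! In logarithms the algorithm is linear. A check node of degree two forwards the message of the
conjugate edge unchanged, because `sTransform` is an involution on positive reals; hence the log
messages satisfy an affine recursion with matrix K, and at time t they equal the sum of K^s w over s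
< t, where w is the log input read at the edges (`xMsg_eq_exp`).

The matrix K moves cyclically through the h classes. Split w into a multiple of the right Perron
vector Z on each class, chosen to match the Y-weighted class sums of w, and a remainder whose class
sums vanish. The first part is rotated and scaled by ρ exactly, so it contributes a geometric sum
with periodic coefficients. The remainder is negligible against ρ^n (`pow_mulVec_isLittleO`): some
power of K is positive within classes (`exists_pow_pos`), and subtracting a small multiple of the
rank-one matrices Z Y on the classes turns this into a contraction. This gives the limit in
`tendsto_sum_pow_mulVec`.

The ingredients are irreducibility (`flowsTo_all`), ρ > 1 (`one_lt_root`), and the passage from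
Perron vectors of the h-step product to eigenvectors of K (`IsPerronPair.isCyclicPerron`).

Equal parity forces convergence through the limit. The converse for messages uses an exact formula
for the class sums after whole periods (`logU_pos_of_logMsg`). For estimates alone it uses a bit
node of degree at least three, where all incoming messages belong to one class
(`logU_nonneg_of_logEstimate`). -/

namespace SPA

/-! ### Scalar limits and periodic geometric sums -/

/-- A quantity that never increases and is contracted by a fixed factor every `M` steps tends to
zero. -/
theorem tendsto_zero_of_antitone_of_contract {f : ℕ → ℝ} (hf : Antitone f) (h0 : ∀ n, 0 ≤ f n)
    {M : ℕ} {κ : ℝ} (hκ : κ < 1) (hM : ∀ n, f (n + M) ≤ κ * f n) : Tendsto f atTop (𝓝 0) := by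
  have hl := tendsto_atTop_ciInf hf ⟨0, by rintro _ ⟨n, rfl⟩; exact h0 n⟩
  set l := ⨅ i, f i
  have h1 : l ≤ κ * l :=
    le_of_tendsto_of_tendsto' ((tendsto_add_atTop_iff_nat M).2 hl) (hl.const_mul κ) hM
  have h2 : 0 ≤ l := ge_of_tendsto' hl h0
  have : l = 0 := by nlinarith
  rwa [this] at hl

/-- A geometric sum with periodic coefficients. -/
theorem sum_range_periodic_geom {ρ : ℝ} (hρ : 1 < ρ) {h : ℕ} (hh : 0 < h) (a : ZMod h → ℝ)
    (i : ZMod h) (q : ℕ) :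
    ∑ s ∈ range (h * q), ρ ^ s * a (i + s) =
      (ρ ^ (h * q) - 1) / (ρ ^ h - 1) * ∑ j ∈ range h, ρ ^ j * a (i + j) := by
  have hne : ρ ^ h - 1 ≠ 0 := (sub_pos.2 (one_lt_pow₀ hρ hh.ne')).ne'
  induction q with
  | zero => simp
  | succ q ih =>
    rw [Nat.mul_succ, sum_range_add, ih]
    have : ∑ x ∈ range h, ρ ^ (h * q + x) * a (i + ((h * q + x : ℕ) : ZMod h)) =
        ρ ^ (h * q) * ∑ j ∈ range h, ρ ^ j * a (i + j) := by
      rw [mul_sum]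
      refine sum_congr rfl fun x _ => ?_
      simp [pow_add, mul_assoc]
    rw [this]
    field_simp
    ring

/-- Splitting off the first r terms leaves whole periods starting at i + r. The split-off part does
not depend on q, so it disappears after normalization. -/
theorem sum_range_add_periodic_geom {ρ : ℝ} (hρ : 1 < ρ) {h : ℕ} (hh : 0 < h) (a : ZMod h → ℝ)
    (i : ZMod h) (q r : ℕ) :
    ∑ s ∈ range (h * q + r), ρ ^ s * a (i + s) = ∑ s ∈ range r, ρ ^ s * a (i + s) +
      ρ ^ r * ((ρ ^ (h * q) - 1) / (ρ ^ h - 1) * ∑ j ∈ range h, ρ ^ j * a (i + r + j)) := by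
  rw [add_comm (h * q), sum_range_add, ← sum_range_periodic_geom hρ hh, mul_sum]
  congr 1
  refine sum_congr rfl fun x _ => ?_
  push_cast
  rw [pow_add, mul_assoc, add_assoc]

/-! ### Perron asymptotics for a cyclic nonnegative matrix -/

section cyclic

variable {E : Type*} [Fintype E]

/-- A nonnegative matrix that moves cyclically through `h` classes, with positive left and right
eigenvectors `Y` and `Z`, normalized on each class. -/
structure IsCyclicPerron (K : Matrix E E ℝ) {h : ℕ} (c : E → ZMod h) (ρ : ℝ) (Y Z : E → ℝ) :
    Prop where
  nonneg : ∀ e f, 0 ≤ K e f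
  cyclic : ∀ e f, K e f ≠ 0 → c f = c e + 1
  root_pos : 0 < ρ
  left_pos : ∀ e, 0 < Y e
  right_pos : ∀ e, 0 < Z e
  left_eigen : Matrix.vecMul Y K = ρ • Y
  right_eigen : Matrix.mulVec K Z = ρ • Z
  normalized : ∀ i, ∑ e with c e = i, Y e * Z e = 1

/-- The total of `v` over the class `i`, weighted by `Y`. -/
def classSum {h : ℕ} (c : E → ZMod h) (Y v : E → ℝ) (i : ZMod h) : ℝ :=
  ∑ e with c e = i, Y e * v e

/-- Columns in class i + 1 have nonzero entries only in rows of class i, so the equation YK = ρY can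
be restricted to a single class. -/
theorem classSum_mulVec {K : Matrix E E ℝ} {h : ℕ} {c : E → ZMod h} {ρ : ℝ} {Y : E → ℝ}
    (hc : ∀ e f, K e f ≠ 0 → c f = c e + 1) (hY : Matrix.vecMul Y K = ρ • Y)
    (v : E → ℝ) (i : ZMod h) :
    classSum c Y (Matrix.mulVec K v) i = ρ * classSum c Y v (i + 1) := by
  simp only [classSum, sum_filter]
  have h1 : ∀ e, (if c e = i then Y e * Matrix.mulVec K v e else 0) =
      ∑ f, if c f = i + 1 then Y e * K e f * v f else 0 := by
    intro e
    rw [Matrix.mulVec, dotProduct, mul_sum]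
    by_cases he : c e = i
    · rw [if_pos he]
      refine sum_congr rfl fun f _ => ?_
      by_cases hK : K e f = 0
      · simp [hK]
      · rw [hc _ _ hK, if_pos (by rw [he]), mul_assoc]
    · rw [if_neg he]
      refine (sum_eq_zero fun f _ => ?_).symm
      by_cases hK : K e f = 0
      · simp [hK]
      · exact if_neg fun hf => he (add_right_cancel ((hc _ _ hK).symm.trans hf))
  simp only [h1]
  rw [sum_comm, mul_sum]
  refine sum_congr rfl fun f _ => ?_
  split_ifs with hf
  · rw [← sum_mul]
    have := congrFun hY f
    simp only [Matrix.vecMul, dotProduct, Pi.smul_apply, smul_eq_mul] at this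
    rw [this, mul_assoc]
  · simp

variable [DecidableEq E]

theorem pow_nonneg_entry {K : Matrix E E ℝ} (hK : ∀ e f, 0 ≤ K e f) (n : ℕ) (e f : E) :
    0 ≤ (K ^ n) e f := by
  induction n generalizing e with
  | zero => rw [pow_zero, Matrix.one_apply]; split_ifs <;> norm_num
  | succ n ih =>
    rw [pow_succ', Matrix.mul_apply]
    exact sum_nonneg fun g _ => mul_nonneg (hK e g) (ih g)

theorem pow_add_entry_pos {K : Matrix E E ℝ} (hK : ∀ e f, 0 ≤ K e f) {m n : ℕ} {e f g : E}
    (h1 : 0 < (K ^ m) e f) (h2 : 0 < (K ^ n) f g) : 0 < (K ^ (m + n)) e g := by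
  rw [pow_add, Matrix.mul_apply]
  exact sum_pos' (fun x _ => mul_nonneg (pow_nonneg_entry hK _ _ _) (pow_nonneg_entry hK _ _ _))
    ⟨f, mem_univ _, mul_pos h1 h2⟩

theorem class_of_pow_entry_ne_zero {K : Matrix E E ℝ} {h : ℕ} {c : E → ZMod h}
    (hc : ∀ e f, K e f ≠ 0 → c f = c e + 1) {n : ℕ} {e f : E} (hn : (K ^ n) e f ≠ 0) :
    c f = c e + n := by
  induction n generalizing e with
  | zero =>
    rw [pow_zero, Matrix.one_apply] at hn
    simp_all
  | succ n ih =>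
    rw [pow_succ', Matrix.mul_apply] at hn
    obtain ⟨g, -, hg⟩ := exists_ne_zero_of_sum_ne_zero hn
    rw [ih (right_ne_zero_of_mul hg), hc _ _ (left_ne_zero_of_mul hg)]
    push_cast
    ring

theorem vecMul_pow_eigen {K : Matrix E E ℝ} {ρ : ℝ} {v : E → ℝ}
    (hv : Matrix.vecMul v K = ρ • v) (n : ℕ) :
    Matrix.vecMul v (K ^ n) = ρ ^ n • v := by
  induction n with
  | zero => simp
  | succ n ih =>
    rw [pow_succ, ← Matrix.vecMul_vecMul, ih, Matrix.smul_vecMul, hv, smul_smul, pow_succ]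

theorem mulVec_pow_eigen {K : Matrix E E ℝ} {ρ : ℝ} {v : E → ℝ}
    (hv : Matrix.mulVec K v = ρ • v) (n : ℕ) :
    Matrix.mulVec (K ^ n) v = ρ ^ n • v := by
  rw [← Matrix.vecMul_transpose, Matrix.transpose_pow]
  exact vecMul_pow_eigen (by rwa [Matrix.vecMul_transpose]) n

namespace IsCyclicPerron

variable {K : Matrix E E ℝ} {h : ℕ} {c : E → ZMod h} {ρ : ℝ} {Y Z : E → ℝ}

theorem classSum_pow_mulVec (H : IsCyclicPerron K c ρ Y Z) (v : E → ℝ) (n : ℕ) (i : ZMod h) :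
    classSum c Y (Matrix.mulVec (K ^ n) v) i = ρ ^ n * classSum c Y v (i + n) := by
  induction n generalizing i with
  | zero => simp
  | succ n ih =>
    rw [pow_succ', ← Matrix.mulVec_mulVec, classSum_mulVec H.cyclic H.left_eigen, ih, pow_succ']
    push_cast
    rw [mul_assoc, add_assoc, add_comm (1 : ZMod h)]

/-- The image of `Z` multiplied by a function of the class. -/
theorem pow_mulVec_right_class (H : IsCyclicPerron K c ρ Y Z) (a : ZMod h → ℝ) (n : ℕ) (e : E) :
    Matrix.mulVec (K ^ n) (fun f => Z f * a (c f)) e = Z e * (ρ ^ n * a (c e + n)) := by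
  have h1 := congrFun (mulVec_pow_eigen H.right_eigen n) e
  simp only [Matrix.mulVec, dotProduct, Pi.smul_apply, smul_eq_mul] at h1 ⊢
  rw [← mul_assoc, mul_comm (Z e), ← h1, sum_mul]
  refine sum_congr rfl fun f _ => ?_
  by_cases hK : (K ^ n) e f = 0
  · simp [hK]
  · rw [class_of_pow_entry_ne_zero H.cyclic hK, mul_assoc]

/-- On vectors of vanishing class sums, a lower bound for `K ^ M` by `δ • Z Y` turns into a
contraction. -/
theorem abs_pow_mulVec_le (H : IsCyclicPerron K c ρ Y Z) {M : ℕ} {δ : ℝ}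
    (hδ : ∀ e f, c f = c e → δ * (Z e * Y f) ≤ (K ^ M) e f) {v : E → ℝ}
    (hv : ∀ i, classSum c Y v i = 0) {C : ℝ} (hC : ∀ e, |v e| ≤ C * Z e) (e : E) :
    |Matrix.mulVec (K ^ M) v e| ≤ C * (ρ ^ M - δ) * Z e := by
  -- Row e of K^M with its rank-one part removed. The removed part annihilates `v`, while pairing
  -- with `Z` it takes away exactly δ Z_e; since `G` is nonnegative, the bound on `v` by `Z` passes
  -- through it.
  set G : E → ℝ := fun f => (K ^ M) e f - if c f = c e then δ * (Z e * Y f) else 0 with hG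
  have hG0 : ∀ f, 0 ≤ G f := by
    intro f
    simp only [hG]
    split_ifs with hf
    · exact sub_nonneg.2 (hδ e f hf)
    · simpa using pow_nonneg_entry H.nonneg M e f
  have key : ∀ x : E → ℝ,
      ∑ f, G f * x f = Matrix.mulVec (K ^ M) x e - δ * Z e * classSum c Y x (c e) := by
    intro x
    rw [classSum, sum_filter, mul_sum, Matrix.mulVec, dotProduct, ← sum_sub_distrib]
    refine sum_congr rfl fun f _ => ?_
    simp only [hG]
    split_ifs <;> ring
  have h1 := key v
  rw [hv, mul_zero, sub_zero] at h1
  have h2 := key Z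
  have h3 : classSum c Y Z (c e) = 1 := H.normalized _
  rw [mulVec_pow_eigen H.right_eigen, h3, Pi.smul_apply, smul_eq_mul] at h2
  calc |Matrix.mulVec (K ^ M) v e| = |∑ f, G f * v f| := by rw [h1]
    _ ≤ ∑ f, |G f * v f| := abs_sum_le_sum_abs _ _
    _ ≤ ∑ f, C * (G f * Z f) := by
        refine sum_le_sum fun f _ => ?_
        rw [abs_mul, abs_of_nonneg (hG0 f), mul_left_comm]
        exact mul_le_mul_of_nonneg_left (hC f) (hG0 f)
    _ = C * (ρ ^ M - δ) * Z e := by rw [← mul_sum, h2]; ring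

/-- For each of the finitely many pairs the left side tends to 0 with δ, while the right side is
fixed and positive. -/
theorem exists_lower_bound {M : ℕ}
    (hM : ∀ e f, c f = c e → 0 < (K ^ M) e f) (Y Z : E → ℝ) :
    ∃ δ : ℝ, 0 < δ ∧ ∀ e f, c f = c e → δ * (Z e * Y f) ≤ (K ^ M) e f := by
  have h1 : ∀ e f, ∀ᶠ δ : ℝ in 𝓝[>] 0, c f = c e → δ * (Z e * Y f) ≤ (K ^ M) e f := by
    intro e f
    by_cases hf : c f = c e
    · have : Tendsto (fun δ : ℝ => δ * (Z e * Y f)) (𝓝[>] 0) (𝓝 (0 * (Z e * Y f))) :=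
        (tendsto_id.mono_left nhdsWithin_le_nhds).mul_const _
      rw [zero_mul] at this
      filter_upwards [this.eventually_lt_const (hM e f hf)] with δ hδ _ using hδ.le
    · exact .of_forall fun _ hf' => absurd hf' hf
  have h2 := eventually_all.2 fun e => eventually_all.2 (h1 e)
  obtain ⟨δ, h3, h4⟩ := (h2.and self_mem_nhdsWithin).exists
  exact ⟨δ, h4, h3⟩

/-- Powers of `K` applied to a vector with vanishing class sums grow more slowly than `ρ ^ n`. -/
theorem pow_mulVec_isLittleO (H : IsCyclicPerron K c ρ Y Z) {M : ℕ}
    (hM : ∀ e f, c f = c e → 0 < (K ^ M) e f) {v : E → ℝ}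
    (hv : ∀ i, classSum c Y v i = 0) (e : E) :
    (fun n => Matrix.mulVec (K ^ n) v e) =o[atTop] fun n => ρ ^ n := by
  obtain ⟨δ, hδ, hle⟩ := exists_lower_bound hM Y Z
  have hρ := H.root_pos
  -- The sup norm weighted by `Z`, for which K/ρ is nonexpansive.
  set F : ℕ → ℝ := fun n => ‖fun e => Matrix.mulVec (K ^ n) v e / (ρ ^ n * Z e)‖ with hF
  have hpos : ∀ n e, 0 < ρ ^ n * Z e := fun n e => mul_pos (pow_pos hρ n) (H.right_pos e)
  have hbound : ∀ n e, |Matrix.mulVec (K ^ n) v e| ≤ F n * ρ ^ n * Z e := by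
    intro n e
    have := norm_le_pi_norm (fun e => Matrix.mulVec (K ^ n) v e / (ρ ^ n * Z e)) e
    rw [Real.norm_eq_abs, abs_div, abs_of_pos (hpos n e), div_le_iff₀ (hpos n e)] at this
    rwa [mul_assoc]
  have hbal : ∀ n i, classSum c Y (Matrix.mulVec (K ^ n) v) i = 0 := by
    intro n i
    rw [H.classSum_pow_mulVec, hv, mul_zero]
  have hF0 : ∀ n, 0 ≤ F n := fun n => norm_nonneg _
  -- Used twice: m = 1 with δ = 0 gives monotonicity, and m = M with the positive δ gives the
  -- contraction.
  have hstep : ∀ m δ, (∀ e f, c f = c e → δ * (Z e * Y f) ≤ (K ^ m) e f) → δ ≤ ρ ^ m → ∀ n,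
      F (n + m) ≤ (ρ ^ m - δ) / ρ ^ m * F n := by
    intro m δ hδ hδm n
    refine (pi_norm_le_iff_of_nonneg
      (mul_nonneg (div_nonneg (sub_nonneg.2 hδm) (pow_pos hρ m).le) (hF0 n))).2 fun e => ?_
    have := H.abs_pow_mulVec_le hδ (hbal n) (hbound n) e
    rw [Matrix.mulVec_mulVec, ← pow_add, add_comm m] at this
    rw [Real.norm_eq_abs, abs_div, abs_of_pos (hpos _ e), div_le_iff₀ (hpos _ e)]
    refine this.trans_eq ?_
    have := (pow_pos hρ m).ne'
    rw [pow_add]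
    field_simp
  have hδM : δ ≤ ρ ^ M := by
    have h3 : classSum c Y Z (c e) = 1 := H.normalized _
    have h1 := congrFun (mulVec_pow_eigen H.right_eigen M) e
    have h4 : δ * Z e * classSum c Y Z (c e) ≤ Matrix.mulVec (K ^ M) Z e := by
      rw [classSum, sum_filter, mul_sum, Matrix.mulVec, dotProduct]
      refine sum_le_sum fun f _ => ?_
      split_ifs with hf
      · have := mul_le_mul_of_nonneg_right (hle e f hf) (H.right_pos f).le
        linarith
      · simpa using mul_nonneg (pow_nonneg_entry H.nonneg M e f) (H.right_pos f).le
    rw [h3, h1, mul_one, Pi.smul_apply, smul_eq_mul] at h4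
    exact le_of_mul_le_mul_right h4 (H.right_pos e)
  have hanti : Antitone F := by
    refine antitone_nat_of_succ_le fun n => ?_
    have := hstep 1 0 (fun e f _ => by simpa using H.nonneg e f) (by simpa using hρ.le) n
    simpa [hρ.ne'] using this
  have hlim : Tendsto F atTop (𝓝 0) := by
    refine tendsto_zero_of_antitone_of_contract hanti hF0 ?_ (hstep M δ hle hδM)
    rw [div_lt_one (pow_pos hρ M)]
    linarith
  rw [Asymptotics.isLittleO_iff_tendsto fun n hn => absurd hn (pow_pos hρ n).ne']
  refine squeeze_zero_norm (a := fun n => F n * Z e) (fun n => ?_)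
    (by simpa using hlim.mul_const (Z e))
  rw [Real.norm_eq_abs, abs_div, abs_of_pos (pow_pos hρ n), div_le_iff₀ (pow_pos hρ n)]
  exact (hbound n e).trans_eq (by ring)

/-- Little-o terms may be summed against a divergent positive series. As ρ > 1, the series of ρ^i
diverges and its partial sums are of order ρ^n. -/
theorem sum_pow_mulVec_isLittleO (H : IsCyclicPerron K c ρ Y Z) (hρ : 1 < ρ) {M : ℕ}
    (hM : ∀ e f, c f = c e → 0 < (K ^ M) e f) {v : E → ℝ}
    (hv : ∀ i, classSum c Y v i = 0) (e : E) :
    (fun n => ∑ s ∈ range n, Matrix.mulVec (K ^ s) v e) =o[atTop] fun n => ρ ^ n := by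
  have hg : ∀ n, ∑ i ∈ range n, ρ ^ i = (ρ ^ n - 1) / (ρ - 1) := fun n => geom_sum_eq hρ.ne' n
  have h1 : Tendsto (fun n => ∑ i ∈ range n, ρ ^ i) atTop atTop := by
    simp only [hg]
    exact (tendsto_atTop_add_const_right _ (-1)
      (tendsto_pow_atTop_atTop_of_one_lt hρ)).atTop_div_const (sub_pos.2 hρ)
  have h2 := (H.pow_mulVec_isLittleO hM hv e).sum_range
    (fun n => (pow_pos H.root_pos n).le) h1
  refine h2.trans_isBigO (Asymptotics.IsBigO.of_bound (1 / (ρ - 1)) (.of_forall fun n => ?_))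
  have h3 : 0 < ρ - 1 := sub_pos.2 hρ
  have h4 : 1 ≤ ρ ^ n := one_le_pow₀ hρ.le
  rw [hg, Real.norm_of_nonneg (div_nonneg (by linarith) h3.le), Real.norm_of_nonneg (by linarith),
    one_div_mul_eq_div]
  gcongr
  linarith

/-- The growth of the partial sums of `K ^ s w`, along a residue class of the number of steps. -/
theorem tendsto_sum_pow_mulVec (H : IsCyclicPerron K c ρ Y Z) (hh : 0 < h) (hρ : 1 < ρ) {M : ℕ}
    (hM : ∀ e f, c f = c e → 0 < (K ^ M) e f) (w : E → ℝ) (r : ℕ) (e : E) :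
    Tendsto (fun q : ℕ => (∑ s ∈ range (h * q + r), Matrix.mulVec (K ^ s) w e) *
        (1 / ρ ^ r * ((ρ ^ h - 1) / (ρ ^ (h * q) - 1)))) atTop
      (𝓝 (Z e * ∑ j ∈ range h, ρ ^ j * classSum c Y w (c e + r + j))) := by
  set a := classSum c Y w with ha
  -- Since Y Z = 1 on each class, this subtraction cancels every class sum of `w`.
  set v : E → ℝ := fun f => w f - Z f * a (c f) with hvdef
  have hv : ∀ i, classSum c Y v i = 0 := by
    intro i
    have h1 : classSum c Y v i = a i - (∑ f with c f = i, Y f * Z f) * a i := by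
      rw [ha, classSum, classSum, sum_mul, ← sum_sub_distrib]
      refine sum_congr rfl fun f hf => ?_
      simp only [hvdef, (mem_filter.1 hf).2, ha, classSum]
      ring
    rw [h1, H.normalized, one_mul, sub_self]
  have hw : w = (fun f => Z f * a (c f)) + v := by ext f; simp [hvdef]
  have hsplit : ∀ n, ∑ s ∈ range n, Matrix.mulVec (K ^ s) w e =
      Z e * ∑ s ∈ range n, ρ ^ s * a (c e + s) + ∑ s ∈ range n, Matrix.mulVec (K ^ s) v e := by
    intro n
    rw [mul_sum, ← sum_add_distrib]
    refine sum_congr rfl fun s _ => ?_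
    rw [hw, Matrix.mulVec_add, Pi.add_apply, H.pow_mulVec_right_class]
  have hq : Tendsto (fun q : ℕ => h * q) atTop atTop := tendsto_id.const_mul_atTop' hh
  have hpow : Tendsto (fun q : ℕ => ρ ^ (h * q)) atTop atTop :=
    (tendsto_pow_atTop_atTop_of_one_lt hρ).comp hq
  have hρr : ρ ^ r ≠ 0 := (pow_pos H.root_pos r).ne'
  have hρh : ρ ^ h - 1 ≠ 0 := (sub_pos.2 (one_lt_pow₀ hρ hh.ne')).ne'
  have hinv : Tendsto (fun q : ℕ => (ρ ^ (h * q) - 1)⁻¹) atTop (𝓝 0) :=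
    (tendsto_atTop_add_const_right _ (-1) hpow).inv_tendsto_atTop
  have herr : Tendsto (fun q : ℕ => (∑ s ∈ range (h * q + r), Matrix.mulVec (K ^ s) v e) *
      (1 / ρ ^ r * ((ρ ^ h - 1) / (ρ ^ (h * q) - 1)))) atTop (𝓝 0) := by
    have h1 := ((H.sum_pow_mulVec_isLittleO hρ hM hv e).tendsto_div_nhds_zero).comp
      ((tendsto_add_atTop_nat r).comp hq)
    -- This is ρ^(hq) (ρ^h - 1) / (ρ^(hq) - 1), the discrepancy between dividing by ρ^(hq+r) and the
    -- normalization in the statement.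
    have h2 : Tendsto (fun q : ℕ => (1 + (ρ ^ (h * q) - 1)⁻¹) * (ρ ^ h - 1)) atTop
        (𝓝 ((1 + 0) * (ρ ^ h - 1))) := (hinv.const_add 1).mul_const _
    have h3 := h1.mul h2
    rw [zero_mul] at h3
    refine h3.congr' ?_
    filter_upwards [hpow.eventually_gt_atTop 1] with q hq1
    have h5 : ρ ^ (h * q) - 1 ≠ 0 := (sub_pos.2 hq1).ne'
    have h6 : ρ ^ (h * q) ≠ 0 := by linarith
    simp only [Function.comp]
    rw [pow_add]
    field_simp
    ring
  have hmain : Tendsto (fun q : ℕ => Z e * ((∑ s ∈ range r, ρ ^ s * a (c e + s)) *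
      (1 / ρ ^ r * ((ρ ^ h - 1) * (ρ ^ (h * q) - 1)⁻¹)) +
        ∑ j ∈ range h, ρ ^ j * a (c e + r + j))) atTop
      (𝓝 (Z e * ((∑ s ∈ range r, ρ ^ s * a (c e + s)) * (1 / ρ ^ r * ((ρ ^ h - 1) * 0)) +
        ∑ j ∈ range h, ρ ^ j * a (c e + r + j)))) :=
    ((((hinv.const_mul _).const_mul _).const_mul _).add_const _).const_mul _
  have h7 := hmain.add herr
  simp only [mul_zero, zero_add, add_zero] at h7
  refine h7.congr' ?_
  filter_upwards [hpow.eventually_gt_atTop 1] with q hq1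
  have h5 : ρ ^ (h * q) - 1 ≠ 0 := (sub_pos.2 hq1).ne'
  rw [hsplit, sum_range_add_periodic_geom hρ hh, add_mul]
  congr 1
  field_simp

end IsCyclicPerron
end cyclic
-- Closed sets of a doubly stochastic matrix
/-- For a doubly stochastic matrix, a set of states closed under successors is closed under
predecessors. -/
theorem pred_mem_of_doublyStochastic {E : Type*} [Fintype E] {P : E → E → ℝ}
    (h0 : ∀ e f, 0 ≤ P e f) (hrow : ∀ e, ∑ f, P e f = 1) (hcol : ∀ f, ∑ e, P e f = 1)
    {S : Finset E} (hS : ∀ e ∈ S, ∀ f, P e f ≠ 0 → f ∈ S) {e f : E} (hf : f ∈ S)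
    (hef : P e f ≠ 0) : e ∈ S := by
  classical
  by_contra he
  -- By rows, the mass flowing from S into S is already |S|; by columns, this is all the mass
  -- entering S. An entry from outside would exceed it.
  have h1 : ∑ f ∈ S, ∑ e ∈ S, P e f = S.card := by
    rw [sum_comm, card_eq_sum_ones, Nat.cast_sum]
    refine sum_congr rfl fun e he => ?_
    rw [Nat.cast_one, ← hrow e]
    refine sum_subset (subset_univ _) fun f _ hf => ?_
    by_contra hne
    exact hf (hS e he f hne)
  have h2 : ∑ f ∈ S, ∑ e, P e f = S.card := by simp [hcol]
  have h3 : ∑ f ∈ S, ∑ e ∈ S, P e f < ∑ f ∈ S, ∑ e, P e f := by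
    refine sum_lt_sum (fun f _ => sum_le_sum_of_subset_of_nonneg (subset_univ _)
      fun e _ _ => h0 e f) ⟨f, hf, ?_⟩
    exact sum_lt_sum_of_subset (subset_univ _) (mem_univ e) he
      ((h0 e f).lt_of_ne' hef) fun e _ _ => h0 e f
  linarith

namespace BipGraph

/-! ### Conjugate edges, the flow matrix and its irreducibility -/

section conj

variable {E L R : Type*} [Fintype E] [DecidableEq E] [DecidableEq R] {B : BipGraph E L R}

theorem existsUnique_conj (hcheck : ∀ c, B.checkDegree c = 2) (e : E) :
    ∃! f, f ≠ e ∧ B.rho f = B.rho e := by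
  have h1 : ((univ.filter fun f => B.rho f = B.rho e).erase e).card = 1 := by
    rw [card_erase_of_mem (by simp)]
    have := hcheck (B.rho e)
    rw [checkDegree] at this
    omega
  obtain ⟨f, hf⟩ := card_eq_one.1 h1
  have h2 : ∀ g, g ≠ e ∧ B.rho g = B.rho e ↔ g = f := by
    intro g
    rw [← mem_singleton (a := f), ← hf]
    simp
  exact ⟨f, (h2 f).2 rfl, fun g hg => (h2 g).1 hg⟩

theorem conj_spec (hcheck : ∀ c, B.checkDegree c = 2) (e : E) :
    B.conj e ≠ e ∧ B.rho (B.conj e) = B.rho e := by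
  have h := existsUnique_conj hcheck e
  rw [conj, dif_pos h]
  exact h.choose_spec.1

theorem eq_conj (hcheck : ∀ c, B.checkDegree c = 2) {e f : E} (h1 : f ≠ e)
    (h2 : B.rho f = B.rho e) : f = B.conj e :=
  (existsUnique_conj hcheck e).unique ⟨h1, h2⟩ (conj_spec hcheck e)

theorem conj_conj (hcheck : ∀ c, B.checkDegree c = 2) (e : E) : B.conj (B.conj e) = e :=
  (eq_conj hcheck (conj_spec hcheck e).1.symm (conj_spec hcheck e).2.symm).symm

theorem conj_involutive (hcheck : ∀ c, B.checkDegree c = 2) : Function.Involutive B.conj :=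
  conj_conj hcheck

theorem filter_rho (hcheck : ∀ c, B.checkDegree c = 2) (e : E) :
    (univ.filter fun f => B.rho f = B.rho e ∧ f ≠ e) = {B.conj e} := by
  ext f
  rw [mem_filter, mem_singleton]
  refine ⟨fun hf => eq_conj hcheck hf.2.2 hf.2.1, ?_⟩
  rintro rfl
  exact ⟨mem_univ _, (conj_spec hcheck e).2, (conj_spec hcheck e).1⟩

end conj

section flow

variable {E L R : Type*} [DecidableEq E] [DecidableEq L] {B : BipGraph E L R}

theorem K_nonneg (e f : E) : 0 ≤ B.K e f := by
  rw [K, Matrix.of_apply]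
  split_ifs <;> norm_num

theorem K_ne_zero {e f : E} : B.K e f ≠ 0 ↔ B.lam (B.conj f) = B.lam e ∧ B.conj f ≠ e := by
  rw [K, Matrix.of_apply]
  split_ifs with h <;> simp [h]

variable [Fintype E]

theorem card_lam_erase (e : E) :
    ((univ.filter fun f => B.lam f = B.lam e ∧ f ≠ e).card : ℝ) = B.bitDegree (B.lam e) - 1 := by
  have h1 : (univ.filter fun f => B.lam f = B.lam e ∧ f ≠ e) =
      (univ.filter fun f => B.lam f = B.lam e).erase e := by
    ext f
    simp [and_comm]
  have h2 : e ∈ univ.filter fun f => B.lam f = B.lam e := by simp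
  rw [h1, card_erase_of_mem h2, Nat.cast_pred (card_pos.2 ⟨e, h2⟩), bitDegree]

theorem sum_K_col (f : E) : ∑ e, B.K e f = B.bitDegree (B.lam (B.conj f)) - 1 := by
  rw [← card_lam_erase, card_eq_sum_ones, Nat.cast_sum, sum_filter]
  refine sum_congr rfl fun e _ => ?_
  rw [K, Matrix.of_apply]
  simp only [eq_comm, ne_eq, Nat.cast_one]

/-- The edge `f` can be followed to the edge `e` in the flow graph. -/
def FlowsTo (B : BipGraph E L R) (f e : E) : Prop := ∃ n, 0 < (B.K ^ n) e f

theorem FlowsTo.refl (e : E) : B.FlowsTo e e := ⟨0, by simp⟩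

theorem FlowsTo.trans {e f g : E} (h1 : B.FlowsTo e f) (h2 : B.FlowsTo f g) : B.FlowsTo e g := by
  obtain ⟨m, hm⟩ := h1
  obtain ⟨n, hn⟩ := h2
  exact ⟨n + m, pow_add_entry_pos K_nonneg hn hm⟩

theorem FlowsTo.single {e f : E} (h : B.K e f ≠ 0) : B.FlowsTo f e :=
  ⟨1, by simpa using (K_nonneg e f).lt_of_ne' h⟩

end flow

variable {E L R : Type*} [Fintype E] [DecidableEq E] [DecidableEq L] [DecidableEq R]
  {B : BipGraph E L R}

/-- Reindexing by conjugation exhibits K as the logarithmic form of the product in `bitToCheck`. -/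
theorem mulVec_K (hcheck : ∀ c, B.checkDegree c = 2) (v : E → ℝ) (e : E) :
    Matrix.mulVec B.K v e =
      ∑ f ∈ univ.filter (fun f => B.lam f = B.lam e ∧ f ≠ e), v (B.conj f) := by
  rw [Matrix.mulVec, dotProduct, ← Equiv.sum_comp (conj_involutive hcheck).toPerm, sum_filter]
  refine sum_congr rfl fun f _ => ?_
  simp [K, conj_conj hcheck]

theorem sum_K_row (hcheck : ∀ c, B.checkDegree c = 2) (e : E) :
    ∑ f, B.K e f = B.bitDegree (B.lam e) - 1 := by
  have h1 := mulVec_K hcheck (fun _ => (1 : ℝ)) e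
  rw [← card_lam_erase, card_eq_sum_ones, Nat.cast_sum]
  simpa [Matrix.mulVec, dotProduct] using h1

/-- The non-backtracking random walk is doubly stochastic, so the flow graph has no transient
part. -/
theorem FlowsTo.symm (hcheck : ∀ c, B.checkDegree c = 2) (hbit : ∀ l, 2 ≤ B.bitDegree l)
    {e f : E} (h : B.FlowsTo e f) : B.FlowsTo f e := by
  classical
  have hdeg : ∀ l, (0 : ℝ) < B.bitDegree l - 1 := fun l => by
    have : (2 : ℝ) ≤ B.bitDegree l := by exact_mod_cast hbit l
    linarith
  -- The row sums are 1 because a nonzero entry forces λ(y) to be the bit node of the conjugate of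
  -- x, so the denominator is constant along the row's support.
  set P : E → E → ℝ := fun x y => B.K y x / (B.bitDegree (B.lam y) - 1) with hP
  have hP0 : ∀ x y, P x y ≠ 0 ↔ B.K y x ≠ 0 := fun x y => by
    simp [hP, (hdeg (B.lam y)).ne']
  have hrow : ∀ x, ∑ y, P x y = 1 := by
    intro x
    have h1 : ∀ y, P x y = B.K y x / (B.bitDegree (B.lam (B.conj x)) - 1) := by
      intro y
      by_cases hK : B.K y x = 0
      · simp [hP, hK]
      · rw [(K_ne_zero.1 hK).1]
    simp only [h1]
    rw [← sum_div, sum_K_col, div_self (hdeg _).ne']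
  have hcol : ∀ y, ∑ x, P x y = 1 := by
    intro y
    rw [← sum_div, sum_K_row hcheck, div_self (hdeg _).ne']
  -- The edges reachable from f are closed under successors, hence under predecessors; one can then
  -- walk backwards from f to e.
  have hpred : ∀ x y, B.FlowsTo f y → B.K y x ≠ 0 → B.FlowsTo f x := by
    intro x y hy hK
    have := pred_mem_of_doublyStochastic (P := P) (S := univ.filter fun g => B.FlowsTo f g)
      (fun x y => div_nonneg (K_nonneg _ _) (hdeg _).le) hrow hcol (e := x) (f := y)
      (fun g hg g' hgg' => by
        rw [mem_filter] at hg ⊢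
        exact ⟨mem_univ _, hg.2.trans (.single ((hP0 _ _).1 hgg'))⟩)
      (by simpa using hy) ((hP0 _ _).2 hK)
    simpa using this
  have hall : ∀ n y, B.FlowsTo f y → (B.K ^ n) y e ≠ 0 → B.FlowsTo f e := by
    intro n
    induction n with
    | zero =>
      intro y hy hn
      rw [pow_zero, Matrix.one_apply] at hn
      have : y = e := by simpa using hn
      rwa [← this]
    | succ n ih =>
      intro y hy hn
      rw [pow_succ', Matrix.mul_apply] at hn
      obtain ⟨g, -, hg⟩ := exists_ne_zero_of_sum_ne_zero hn
      exact ih g (hpred g y hy (left_ne_zero_of_mul hg)) (right_ne_zero_of_mul hg)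
  obtain ⟨n, hn⟩ := h
  exact hall n f (.refl f) hn.ne'

/-- The flow matrix is irreducible. -/
theorem flowsTo_all (hconn : B.toDirGraph.symm.Connected) (hcheck : ∀ c, B.checkDegree c = 2)
    (hbit : ∀ l, 2 ≤ B.bitDegree l) (hbit3 : ∃ l, 3 ≤ B.bitDegree l) (e f : E) :
    B.FlowsTo e f := by
  obtain ⟨l, hl⟩ := hbit3
  have hsymm : ∀ {e f : E}, B.FlowsTo e f → B.FlowsTo f e := fun h => h.symm hcheck hbit
  have hturn : ∀ {e f : E}, B.lam e = B.lam f → e ≠ f → B.FlowsTo (B.conj e) f := by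
    intro e f h1 h2
    exact .single (K_ne_zero.2 (by rw [conj_conj hcheck]; exact ⟨h1, h2⟩))
  -- at a bit node of degree at least three everything can be turned around
  have hback : ∀ e, B.lam e = l → B.FlowsTo (B.conj e) e := by
    intro e he
    have h1 : 1 < ((univ.filter fun f => B.lam f = l).erase e).card := by
      rw [card_erase_of_mem (by simpa using he)]
      rw [bitDegree] at hl
      omega
    obtain ⟨f, hf, g, hg, hfg⟩ := one_lt_card.1 h1
    simp only [mem_erase, mem_filter, mem_univ, true_and] at hf hg
    -- The route is from the conjugate of e to f, then to the conjugate of g by reversing a turn,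
    -- then to e.
    exact (hturn (he.trans hf.2.symm) hf.1.symm).trans
      ((hsymm (hturn (hg.2.trans hf.2.symm) hfg.symm)).trans
        (hturn (hg.2.trans he.symm) hg.1))
  obtain ⟨e₀, he₀⟩ : ∃ e, B.lam e = l := by
    have : 0 < B.bitDegree l := by omega
    obtain ⟨e, he⟩ := card_pos.1 this
    exact ⟨e, by simpa using he⟩
  -- Both orientations are tracked together: this property passes to the conjugate and to every edge
  -- at the same bit node, so it spreads along the connected graph.
  let Q : E → Prop := fun e => B.FlowsTo e₀ e ∧ B.FlowsTo e₀ (B.conj e)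
  have hQconj : ∀ e, Q e → Q (B.conj e) := fun e he => ⟨he.2, by rw [conj_conj hcheck]; exact he.1⟩
  have hQlam : ∀ e f, B.lam e = B.lam f → Q e → Q f := by
    intro e f hef he
    by_cases h : e = f
    · rwa [← h]
    · exact ⟨he.2.trans (hturn hef h), he.1.trans (hsymm (hturn hef.symm (Ne.symm h)))⟩
  have hQ₀ : Q e₀ := ⟨.refl _, hsymm (hback e₀ he₀)⟩
  let T : L ⊕ R → Prop :=
    Sum.elim (fun l => ∀ e, B.lam e = l → Q e) (fun c => ∀ e, B.rho e = c → Q e)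
  have hT : ∀ v, T v := by
    intro v
    induction hconn (Sum.inl l) v with
    | refl => exact fun e he => hQlam e₀ e (he₀.trans he.symm) hQ₀
    | tail _ hstep ih =>
      obtain ⟨a, rfl, rfl⟩ := hstep
      cases a with
      | inl a =>
        have ha : Q a := ih a rfl
        intro e he
        by_cases h : e = a
        · rwa [h]
        · rw [eq_conj hcheck h he]
          exact hQconj a ha
      | inr a =>
        have ha : Q a := ih a rfl
        exact fun e he => hQlam a e he.symm ha
  have hall : ∀ e, B.FlowsTo e₀ e := fun e => (hT (Sum.inl (B.lam e)) e rfl).1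
  exact (hsymm (hall e)).trans (hall f)

/-! ### Cycles and positivity of powers within classes -/

/-- Nonzero entries of the flow matrix are edges of the flow graph. -/
theorem K_ne_zero_iff_flow (hcheck : ∀ c, B.checkDegree c = 2) {e f : E} : B.K e f ≠ 0 ↔
    B.assocGraph.tgt f = B.assocGraph.src e ∧ B.conj e ≠ f := by
  rw [K_ne_zero, ← (conj_involutive hcheck).injective.ne_iff (x := B.conj f), conj_conj hcheck,
    ne_comm (a := f)]
  rfl

theorem K_class (hcheck : ∀ c, B.checkDegree c = 2) {h : ℕ} {cls : E → ℕ}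
    (hcls : B.IsCyclicPartition h cls) {e f : E}
    (hK : B.K e f ≠ 0) : (cls f : ZMod h) = cls e + 1 := by
  have := hcls.2 ⟨(f, e), (K_ne_zero_iff_flow hcheck).1 hK⟩
  rw [← ZMod.natCast_eq_natCast_iff] at this
  simpa [flowGraph] using this

theorem pow_pos_of_cycle (hcheck : ∀ c, B.checkDegree c = 2) {n : ℕ}
    (hn : n ∈ B.flowGraph.cycleLengths) :
    0 < n ∧ ∃ e, 0 < (B.K ^ n) e e := by
  obtain ⟨hn0, w, hw, hclose⟩ := hn
  refine ⟨hn0, B.flowGraph.src (w 0), ?_⟩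
  have hedge : ∀ a, 0 < B.K (B.flowGraph.tgt a) (B.flowGraph.src a) := 
    fun a => (K_nonneg _ _).lt_of_ne' ((K_ne_zero_iff_flow hcheck).2 a.2)
  have h1 : ∀ j < n, 0 < (B.K ^ (j + 1)) (B.flowGraph.tgt (w j)) (B.flowGraph.src (w 0)) := by
    intro j
    induction j with
    | zero => intro _; simpa using hedge (w 0)
    | succ j ih =>
      intro hj
      have h2 := ih (by omega)
      rw [hw j hj] at h2
      have := pow_add_entry_pos (m := 1) K_nonneg (by simpa using hedge (w (j + 1))) h2
      rwa [add_comm] at this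
  have h2 := h1 (n - 1) (by omega)
  rwa [Nat.sub_add_cancel hn0, hclose] at h2

/-- Within the classes, a high power of the flow matrix is positive. -/
theorem exists_pow_pos (hcheck : ∀ c, B.checkDegree c = 2) {h : ℕ}
    (hh : B.IsImprimitivityIndex h) {cls : E → ℕ}
    (hcls : B.IsCyclicPartition h cls) (hirr : ∀ e f, B.FlowsTo e f) (hne : ∃ e f, B.K e f ≠ 0) :
    ∃ M, ∀ e f, (cls f : ZMod h) = cls e → 0 < (B.K ^ M) e f := by
  have hdvd : ∀ {e f n}, (cls f : ZMod h) = cls e → 0 < (B.K ^ n) e f → h ∣ n := by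
    intro e f n hef hn
    have := class_of_pow_entry_ne_zero (c := fun e => (cls e : ZMod h))
      (fun _ _ => K_class hcheck hcls) hn.ne'
    rw [hef, left_eq_add] at this
    exact (ZMod.natCast_eq_zero_iff n h).1 this
  -- The return times at e form an additive monoid, which contains all large multiples of its gcd.
  -- It remains to identify that gcd with h.
  have hdiag : ∀ e, ∃ N, ∀ m ≥ N, h ∣ m → 0 < (B.K ^ m) e e := by
    intro e
    set S : Set ℕ := {n | 0 < (B.K ^ n) e e} with hS
    have hclosed : ∀ m ∈ AddSubmonoid.closure S, m ∈ S := by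
      intro m hm
      induction hm using AddSubmonoid.closure_induction with
      | mem x hx => exact hx
      | zero => simp [hS]
      | add x y _ _ hx hy => exact pow_add_entry_pos K_nonneg hx hy
    have h1 : Nat.setGcd S ∣ h := by
      -- The gcd divides each cycle length n: for a cycle through f, both a + b and a + n + b are
      -- return times at e via f. Maximality of h then applies.
      have hle : Nat.setGcd S ≤ h := by
        refine hh.2 fun n hn => ?_
        obtain ⟨-, f, hf⟩ := pow_pos_of_cycle hcheck hn
        obtain ⟨a, ha⟩ := hirr f e
        obtain ⟨b, hb⟩ := hirr e f
        have h2 := Nat.setGcd_dvd_of_mem (s := S) (pow_add_entry_pos K_nonneg ha hb)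
        have h3 := Nat.setGcd_dvd_of_mem (s := S)
          (pow_add_entry_pos K_nonneg (pow_add_entry_pos K_nonneg ha hf) hb)
        rw [add_right_comm] at h3
        exact (Nat.dvd_add_right h2).1 h3
      have hdiv : h ∣ Nat.setGcd S := Nat.dvd_setGcd_iff.2 fun m hm => hdvd rfl hm
      have hpos : Nat.setGcd S ≠ 0 := by
        rw [Ne, Nat.setGcd_eq_zero_iff]
        intro hsub
        obtain ⟨x, y, hxy⟩ := hne
        obtain ⟨a, ha⟩ := hirr x e
        obtain ⟨b, hb⟩ := hirr e y
        have := hsub (pow_add_entry_pos K_nonneg (pow_add_entry_pos K_nonneg (n := 1) ha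
          (by simpa using (K_nonneg x y).lt_of_ne' hxy)) hb)
        simp at this
      rw [hle.antisymm (Nat.le_of_dvd (Nat.pos_of_ne_zero hpos) hdiv)]
    obtain ⟨N, hN⟩ := Nat.exists_mem_closure_of_ge S
    exact ⟨N, fun m hm hd => hclosed m (hN m hm (h1.trans hd))⟩
  -- A fixed path from f to e is extended by long returns at e. Positivity holds for all large q, so
  -- one exponent serves all pairs.
  have hpair : ∀ e f, ∀ᶠ q in atTop, (cls f : ZMod h) = cls e → 0 < (B.K ^ (h * q)) e f := by
    intro e f
    by_cases hef : (cls f : ZMod h) = cls e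
    · obtain ⟨N, hN⟩ := hdiag e
      obtain ⟨a, ha⟩ := hirr f e
      obtain ⟨k, rfl⟩ := hdvd hef ha
      have hh0 : 0 < h := (hcls.1 e).1.trans (hcls.1 e).2
      filter_upwards [eventually_ge_atTop (N + k)] with q hq _
      obtain ⟨j, rfl⟩ := Nat.exists_eq_add_of_le' (le_of_add_le_right hq)
      rw [mul_add]
      refine pow_add_entry_pos K_nonneg (hN _ ?_ (dvd_mul_right _ _)) ha
      exact (by omega : N ≤ j).trans (Nat.le_mul_of_pos_left _ hh0)
    · exact .of_forall fun _ hf => absurd hf hef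
  obtain ⟨q, hq⟩ := (eventually_all.2 fun e => eventually_all.2 (hpair e)).exists
  exact ⟨h * q, hq⟩

end BipGraph
-- From block products to eigenvectors of the whole matrix
theorem block_eq {E : Type*} {K : Matrix E E ℝ} {h : ℕ} {cls : E → ℕ}
    (hc : ∀ e f, K e f ≠ 0 → (cls f : ZMod h) = cls e + 1)
    {i : ℕ} {e f : E} (hi : (cls e : ZMod h) = i ∨ (cls f : ZMod h) = i + 1) :
    block K h cls i e f = K e f := by
  rw [block, Matrix.of_apply]
  by_cases hK : K e f = 0
  · simp [hK]
  · have h1 := hc e f hK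
    have h2 : (cls e : ZMod h) = i := hi.elim id fun h2 => add_right_cancel (h1.symm.trans h2)
    rw [if_pos]
    constructor
    · exact (ZMod.natCast_eq_natCast_iff _ _ _).1 h2
    · rw [← ZMod.natCast_eq_natCast_iff, h1, h2]
      push_cast
      rfl

section perronVectors

variable {E : Type*} [Fintype E]

/-- The vector `v` is supported on the class `i`. -/
def SupportedOn {h : ℕ} (c : E → ZMod h) (i : ZMod h) (v : E → ℝ) : Prop :=
  ∀ e, v e ≠ 0 → c e = i

variable [DecidableEq E] {K : Matrix E E ℝ} {h : ℕ} {cls : E → ℕ}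

theorem SupportedOn.vecMul_pow {c : E → ZMod h} (hc : ∀ e f, K e f ≠ 0 → c f = c e + 1)
    {i : ZMod h} {v : E → ℝ} (hv : SupportedOn c i v) (n : ℕ) :
    SupportedOn c (i + n) (Matrix.vecMul v (K ^ n)) := by
  intro f hf
  obtain ⟨e, -, he⟩ := exists_ne_zero_of_sum_ne_zero hf
  rw [class_of_pow_entry_ne_zero hc (right_ne_zero_of_mul he), hv e (left_ne_zero_of_mul he)]

theorem SupportedOn.mulVec_pow {c : E → ZMod h} (hc : ∀ e f, K e f ≠ 0 → c f = c e + 1)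
    {i : ZMod h} {n : ℕ} {v : E → ℝ} (hv : SupportedOn c (i + n) v) :
    SupportedOn c i (Matrix.mulVec (K ^ n) v) := by
  intro e he
  obtain ⟨f, -, hf⟩ := exists_ne_zero_of_sum_ne_zero he
  have h1 := class_of_pow_entry_ne_zero hc (left_ne_zero_of_mul hf)
  rw [hv f (right_ne_zero_of_mul hf)] at h1
  exact (add_right_cancel h1).symm

/-- The support advances one class per factor, so each block acts on the vector it meets exactly as
K does. -/
theorem vecMul_blockProd (hc : ∀ e f, K e f ≠ 0 → (cls f : ZMod h) = cls e + 1)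
    {i : ℕ} {v : E → ℝ} (n : ℕ)
    (hv : SupportedOn (fun e => (cls e : ZMod h)) i v) :
    Matrix.vecMul v (blockProd K h cls i n) = Matrix.vecMul v (K ^ n) := by
  induction n generalizing i v with
  | zero => simp [blockProd]
  | succ n ih =>
    have h1 : Matrix.vecMul v (block K h cls i) = Matrix.vecMul v K := by
      ext f
      refine sum_congr rfl fun e _ => ?_
      by_cases he : v e = 0
      · simp [he]
      · exact congrArg (v e * ·) (block_eq hc (.inl (hv e he)))
    have h2 := hv.vecMul_pow hc 1
    rw [pow_one] at h2
    rw [blockProd, ← Matrix.vecMul_vecMul, h1, ih (by exact_mod_cast h2), Matrix.vecMul_vecMul,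
      pow_succ']

theorem blockProd_mulVec (hc : ∀ e f, K e f ≠ 0 → (cls f : ZMod h) = cls e + 1)
    {i n : ℕ} {v : E → ℝ}
    (hv : SupportedOn (fun e => (cls e : ZMod h)) ((i + n : ℕ) : ZMod h) v) :
    Matrix.mulVec (blockProd K h cls i n) v = Matrix.mulVec (K ^ n) v := by
  induction n generalizing i with
  | zero => simp [blockProd]
  | succ n ih =>
    rw [add_comm n, ← add_assoc] at hv
    rw [blockProd, ← Matrix.mulVec_mulVec, ih hv, pow_succ', ← Matrix.mulVec_mulVec]
    rw [Nat.cast_add] at hv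
    have h1 := hv.mulVec_pow hc
    ext e
    refine sum_congr rfl fun f _ => ?_
    by_cases hf : Matrix.mulVec (K ^ n) v f = 0
    · simp [hf]
    · exact congrArg (· * Matrix.mulVec (K ^ n) v f)
        (block_eq hc (.inr (by exact_mod_cast h1 f hf)))

/-- Irreducibility carries one positive entry to any f through v K^n = ρ^n v. -/
theorem left_eigenvector_pos (hK : ∀ e f, 0 ≤ K e f) (hirr : ∀ e f, ∃ n, 0 < (K ^ n) e f)
    {ρ : ℝ} (hρ : 0 < ρ) {v : E → ℝ} (hv : Matrix.vecMul v K = ρ • v) (h0 : ∀ e, 0 ≤ v e)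
    (hne : ∃ e, 0 < v e) (f : E) : 0 < v f := by
  obtain ⟨e, he⟩ := hne
  obtain ⟨n, hn⟩ := hirr e f
  have h1 := congrFun (vecMul_pow_eigen hv n) f
  have h2 : 0 < Matrix.vecMul v (K ^ n) f :=
    sum_pos' (fun x _ => mul_nonneg (h0 x) (pow_nonneg_entry hK n x f))
      ⟨e, mem_univ _, mul_pos he hn⟩
  rw [h1, Pi.smul_apply, smul_eq_mul] at h2
  exact pos_of_mul_pos_right h2 (pow_pos hρ n).le

theorem right_eigenvector_pos (hK : ∀ e f, 0 ≤ K e f) (hirr : ∀ e f, ∃ n, 0 < (K ^ n) e f)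
    {ρ : ℝ} (hρ : 0 < ρ) {v : E → ℝ} (hv : Matrix.mulVec K v = ρ • v) (h0 : ∀ e, 0 ≤ v e)
    (hne : ∃ e, 0 < v e) (f : E) : 0 < v f :=
  left_eigenvector_pos (K := K.transpose) (fun e f => hK f e)
    (fun e f => by simpa [← Matrix.transpose_pow] using hirr f e) hρ
    (by rwa [Matrix.vecMul_transpose]) h0 hne f

/-- Averaging an eigenvector of `K ^ h` over the powers of `K` gives an eigenvector of `K`. -/
theorem vecMul_sum_pow_eigen {ρ : ℝ} (hρ : ρ ≠ 0) {v : E → ℝ}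
    (hv : Matrix.vecMul v (K ^ h) = ρ ^ h • v) :
    Matrix.vecMul (∑ n ∈ range h, ρ⁻¹ ^ n • Matrix.vecMul v (K ^ n)) K =
      ρ • ∑ n ∈ range h, ρ⁻¹ ^ n • Matrix.vecMul v (K ^ n) := by
  have h1 : ∀ n, Matrix.vecMul (ρ⁻¹ ^ n • Matrix.vecMul v (K ^ n)) K =
      ρ • (ρ⁻¹ ^ (n + 1) • Matrix.vecMul v (K ^ (n + 1))) := by
    intro n
    rw [Matrix.smul_vecMul, Matrix.vecMul_vecMul, ← pow_succ, smul_smul, pow_succ' ρ⁻¹,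
      ← mul_assoc, mul_inv_cancel₀ hρ, one_mul]
  have h2 := sum_range_succ' (fun n => ρ⁻¹ ^ n • Matrix.vecMul v (K ^ n)) h
  rw [sum_range_succ, hv, smul_smul, ← mul_pow, inv_mul_cancel₀ hρ] at h2
  simp only [one_pow, one_smul, pow_zero, Matrix.vecMul_one] at h2
  rw [Matrix.sum_vecMul, sum_congr rfl fun n _ => h1 n, ← smul_sum, ← add_right_cancel h2]

/-- The transpose of the previous lemma. Exponents run over 1, ..., h, since `zVec` uses a full turn
of h blocks on class 1; the sum is unchanged because the terms for 0 and h agree. -/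
theorem mulVec_sum_pow_eigen {ρ : ℝ} (hρ : ρ ≠ 0) {v : E → ℝ}
    (hv : Matrix.mulVec (K ^ h) v = ρ ^ h • v) :
    Matrix.mulVec K (∑ n ∈ range h, ρ⁻¹ ^ (n + 1) • Matrix.mulVec (K ^ (n + 1)) v) =
      ρ • ∑ n ∈ range h, ρ⁻¹ ^ (n + 1) • Matrix.mulVec (K ^ (n + 1)) v := by
  have h1 := vecMul_sum_pow_eigen (K := K.transpose) (v := v) (h := h) hρ
    (by rwa [← Matrix.transpose_pow, Matrix.vecMul_transpose])
  simp only [← Matrix.transpose_pow, Matrix.vecMul_transpose] at h1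
  have h2 := sum_range_succ' (fun n => ρ⁻¹ ^ n • Matrix.mulVec (K ^ n) v) h
  rw [sum_range_succ, hv, smul_smul, ← mul_pow, inv_mul_cancel₀ hρ] at h2
  simp only [one_pow, one_smul, pow_zero, Matrix.one_mulVec] at h2
  rwa [← add_right_cancel h2]

variable {ρ : ℝ} {y₁ z₁ : E → ℝ}

theorem IsPerronPair.supportedOn_left (hyz : IsPerronPair K ρ h cls y₁ z₁) :
    SupportedOn (fun e => (cls e : ZMod h)) (1 : ℕ) y₁ := fun e he => by
  have h1 : cls e = 1 := not_imp_comm.1 (hyz.y_zero e) he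
  simp [h1]

theorem IsPerronPair.supportedOn_right (hyz : IsPerronPair K ρ h cls y₁ z₁) :
    SupportedOn (fun e => (cls e : ZMod h)) (1 : ℕ) z₁ := fun e he => by
  have h1 : cls e = 1 := not_imp_comm.1 (hyz.z_zero e) he
  simp [h1]

theorem IsPerronPair.left_nonneg (hyz : IsPerronPair K ρ h cls y₁ z₁) (e : E) : 0 ≤ y₁ e := by
  by_cases h1 : cls e = 1
  · exact (hyz.y_pos e h1).le
  · exact (hyz.y_zero e h1).ge

theorem IsPerronPair.right_nonneg (hyz : IsPerronPair K ρ h cls y₁ z₁) (e : E) : 0 ≤ z₁ e := by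
  by_cases h1 : cls e = 1
  · exact (hyz.z_pos e h1).le
  · exact (hyz.z_zero e h1).ge

theorem IsPerronPair.exists_class_one (hyz : IsPerronPair K ρ h cls y₁ z₁) : ∃ e, cls e = 1 := by
  have h1 : y₁ ⬝ᵥ z₁ ≠ 0 := by rw [hyz.normalized]; norm_num
  obtain ⟨e, -, he⟩ := exists_ne_zero_of_sum_ne_zero h1
  exact ⟨e, not_imp_comm.1 (hyz.y_zero e) (left_ne_zero_of_mul he)⟩

/-- The summands live on different classes, so at e only n = `cls e - 1` contributes. -/
theorem yVec_eq_sum (hc : ∀ e f, K e f ≠ 0 → (cls f : ZMod h) = cls e + 1)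
    (hcls : ∀ e, 1 ≤ cls e ∧ cls e ≤ h) (hyz : IsPerronPair K ρ h cls y₁ z₁) :
    yVec K ρ h cls y₁ = ∑ n ∈ range h, ρ⁻¹ ^ n • Matrix.vecMul y₁ (K ^ n) := by
  ext e
  obtain ⟨h1, h2⟩ := hcls e
  rw [Finset.sum_apply, sum_eq_single (cls e - 1)]
  · rw [yVec, vecMul_blockProd hc _ hyz.supportedOn_left, Pi.smul_apply, smul_eq_mul]
    congr 1
    rw [inv_pow, ← zpow_natCast, ← zpow_neg, Nat.cast_sub h1]
    congr 1
    ring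
  · intro n hn hne
    rw [mem_range] at hn
    rw [Pi.smul_apply, smul_eq_mul]
    by_contra h0
    have h3 : (cls e : ZMod h) = (1 : ℕ) + n :=
      hyz.supportedOn_left.vecMul_pow hc n e (right_ne_zero_of_mul h0)
    have h4 : ((cls e - 1 : ℕ) : ZMod h) = n := by
      rw [Nat.cast_sub h1, h3]
      ring
    have h5 := Nat.ModEq.eq_of_lt_of_lt ((ZMod.natCast_eq_natCast_iff _ _ _).1 h4) (by omega) hn
    exact hne h5.symm
  · intro h3
    rw [mem_range] at h3
    omega

theorem zVec_eq_sum (hc : ∀ e f, K e f ≠ 0 → (cls f : ZMod h) = cls e + 1)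
    (hcls : ∀ e, 1 ≤ cls e ∧ cls e ≤ h) (hyz : IsPerronPair K ρ h cls y₁ z₁) :
    zVec K ρ h cls z₁ = ∑ n ∈ range h, ρ⁻¹ ^ (n + 1) • Matrix.mulVec (K ^ (n + 1)) z₁ := by
  ext e
  obtain ⟨h1, h2⟩ := hcls e
  rw [Finset.sum_apply, sum_eq_single (h - cls e)]
  · have h3 : h + 1 - cls e = h - cls e + 1 := by omega
    rw [zVec, blockProd_mulVec hc, Pi.smul_apply, smul_eq_mul, h3]
    · congr 1
      rw [inv_pow, ← zpow_natCast, ← zpow_neg, Nat.cast_add, Nat.cast_sub h2]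
      congr 1
      push_cast
      ring
    · have h4 : ((cls e + (h + 1 - cls e) : ℕ) : ZMod h) = (1 : ℕ) := by
        rw [show cls e + (h + 1 - cls e) = h + 1 by omega]
        simp
      rw [h4]
      exact hyz.supportedOn_right
  · intro n hn hne
    rw [mem_range] at hn
    rw [Pi.smul_apply, smul_eq_mul]
    by_contra h0
    have h3 : SupportedOn (fun e => (cls e : ZMod h)) (1 - ((n + 1 : ℕ) : ZMod h) +
      ((n + 1 : ℕ) : ZMod h)) z₁ := by
      simpa using hyz.supportedOn_right
    have h4 := h3.mulVec_pow hc e (right_ne_zero_of_mul h0)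
    have h5 : ((cls e + n : ℕ) : ZMod h) = 0 := by
      rw [Nat.cast_add, h4]
      push_cast
      ring
    -- As 0 < `cls e + n` < 2h, divisibility by h leaves only `cls e + n = h`, contrary to the
    -- choice of n.
    obtain ⟨k, hk⟩ := (ZMod.natCast_eq_zero_iff _ _).1 h5
    have h6 : k = 1 := by
      have : 0 < k := Nat.pos_of_ne_zero (by rintro rfl; omega)
      have : k < 2 := by
        by_contra hk2
        have : h * 2 ≤ h * k := Nat.mul_le_mul_left _ (by omega)
        omega
      omega
    subst h6
    omega
  · intro h3
    rw [mem_range] at h3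
    omega

theorem IsPerronPair.isCyclicPerron (hK : ∀ e f, 0 ≤ K e f)
    (hirr : ∀ e f, ∃ n, 0 < (K ^ n) e f)
    (hc : ∀ e f, K e f ≠ 0 → (cls f : ZMod h) = cls e + 1)
    (hcls : ∀ e, 1 ≤ cls e ∧ cls e ≤ h) (hρ : 0 < ρ) (hyz : IsPerronPair K ρ h cls y₁ z₁) :
    IsCyclicPerron K (fun e => (cls e : ZMod h)) ρ (yVec K ρ h cls y₁) (zVec K ρ h cls z₁) := by
  obtain ⟨e₁, he₁⟩ := hyz.exists_class_one
  have hh : 1 ≤ h := (hcls e₁).1.trans (hcls e₁).2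
  have : NeZero h := ⟨by omega⟩
  have hyK : Matrix.vecMul y₁ (K ^ h) = ρ ^ h • y₁ := by
    rw [← vecMul_blockProd hc _ hyz.supportedOn_left, hyz.y_eigen]
  have hzK : Matrix.mulVec (K ^ h) z₁ = ρ ^ h • z₁ := by
    rw [← blockProd_mulVec hc, hyz.z_eigen]
    simpa using hyz.supportedOn_right
  have hY : Matrix.vecMul (yVec K ρ h cls y₁) K = ρ • yVec K ρ h cls y₁ := by
    rw [yVec_eq_sum hc hcls hyz]
    exact vecMul_sum_pow_eigen hρ.ne' hyK
  have hZ : Matrix.mulVec K (zVec K ρ h cls z₁) = ρ • zVec K ρ h cls z₁ := by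
    rw [zVec_eq_sum hc hcls hyz]
    exact mulVec_sum_pow_eigen hρ.ne' hzK
  have hY1 : ∀ e, cls e = 1 → yVec K ρ h cls y₁ e = y₁ e := fun e he => by
    simp [yVec, he, blockProd]
  have hZ1 : ∀ e, cls e = 1 → zVec K ρ h cls z₁ e = z₁ e := fun e he => by
    have h1 : ((1 : ℕ) : ℤ) - h - 1 = -(h : ℤ) := by push_cast; ring
    rw [zVec, he, Nat.add_sub_cancel, hyz.z_eigen, Pi.smul_apply, smul_eq_mul, ← mul_assoc, h1,
      zpow_neg, zpow_natCast, inv_mul_cancel₀ (pow_pos hρ h).ne', one_mul]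
  have hY0 : ∀ e, 0 ≤ yVec K ρ h cls y₁ e := by
    intro e
    rw [yVec_eq_sum hc hcls hyz, Finset.sum_apply]
    exact sum_nonneg fun n _ => mul_nonneg (pow_nonneg (inv_nonneg.2 hρ.le) n)
      (sum_nonneg fun f _ => mul_nonneg (hyz.left_nonneg f) (pow_nonneg_entry hK _ _ _))
  have hZ0 : ∀ e, 0 ≤ zVec K ρ h cls z₁ e := by
    intro e
    rw [zVec_eq_sum hc hcls hyz, Finset.sum_apply]
    exact sum_nonneg fun n _ => mul_nonneg (pow_nonneg (inv_nonneg.2 hρ.le) _)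
      (sum_nonneg fun f _ => mul_nonneg (pow_nonneg_entry hK _ _ _) (hyz.right_nonneg f))
  refine ⟨hK, hc, hρ, left_eigenvector_pos hK hirr hρ hY hY0 ⟨e₁, ?_⟩,
    right_eigenvector_pos hK hirr hρ hZ hZ0 ⟨e₁, ?_⟩, hY, hZ, ?_⟩
  · rw [hY1 e₁ he₁]
    exact hyz.y_pos e₁ he₁
  · rw [hZ1 e₁ he₁]
    exact hyz.z_pos e₁ he₁
  · set c : E → ZMod h := fun e => (cls e : ZMod h) with hcdef
    have hone : classSum c (yVec K ρ h cls y₁) (zVec K ρ h cls z₁) 1 = 1 := by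
      rw [← hyz.normalized, classSum, sum_filter]
      refine sum_congr rfl fun e _ => ?_
      have h1 : c e = 1 ↔ cls e = 1 := by
        constructor
        · intro h1
          have h2 : ((cls e - 1 : ℕ) : ZMod h) = 0 := by
            rw [Nat.cast_sub (hcls e).1]
            simpa [sub_eq_zero] using h1
          have h3 := Nat.eq_zero_of_dvd_of_lt ((ZMod.natCast_eq_zero_iff _ _).1 h2)
            (by have := hcls e; omega)
          have := (hcls e).1
          omega
        · intro h1
          simp [hcdef, h1]
      by_cases he : cls e = 1
      · rw [if_pos (h1.2 he), hY1 e he, hZ1 e he]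
      · rw [if_neg (he ∘ h1.1), hyz.y_zero e he, zero_mul]
    -- Applying K to Z multiplies by ρ, and also turns the class sum at i into ρ times the one at i
    -- + 1; so the normalization on class 1 travels around the cycle.
    have hall : ∀ n : ℕ, classSum c (yVec K ρ h cls y₁) (zVec K ρ h cls z₁) (1 + n) = 1 := by
      intro n
      induction n with
      | zero => simpa using hone
      | succ n ih =>
        have h1 := classSum_mulVec (c := c) hc hY (zVec K ρ h cls z₁) (1 + n)
        rw [hZ] at h1
        have h2 : classSum c (yVec K ρ h cls y₁) (ρ • zVec K ρ h cls z₁) (1 + n) =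
            ρ * classSum c (yVec K ρ h cls y₁) (zVec K ρ h cls z₁) (1 + n) := by
          rw [classSum, classSum, mul_sum]
          exact sum_congr rfl fun e _ => mul_left_comm _ _ _
        rw [h2] at h1
        have h3 := mul_left_cancel₀ hρ.ne' h1
        push_cast
        rw [← add_assoc, ← h3, ih]
    intro i
    have := hall (i - 1).val
    rwa [ZMod.natCast_zmod_val, add_sub_cancel] at this

end perronVectors
-- Limits along residue classes and the normalizing scale
theorem tendsto_of_residues {α : Type*} {f : ℕ → α} {l : Filter α} {h : ℕ} (hh : 0 < h)
    (hf : ∀ r < h, Tendsto (fun q => f (h * q + r)) atTop l) : Tendsto f atTop l := by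
  intro s hs
  have h1 : ∀ᶠ q in atTop, ∀ r ∈ range h, f (h * q + r) ∈ s :=
    (eventually_all_finset _).2 fun r hr => hf r (mem_range.1 hr) hs
  obtain ⟨N, hN⟩ := eventually_atTop.1 h1
  refine eventually_atTop.2 ⟨h * N, fun t ht => ?_⟩
  have h2 := hN (t / h) ((Nat.le_div_iff_mul_le hh).2 (by rwa [mul_comm])) (t % h)
    (mem_range.2 (Nat.mod_lt _ hh))
  rwa [Nat.div_add_mod] at h2

theorem tendsto_atTop_of_scaled {f α : ℕ → ℝ} {b : ℝ} (hb : 0 < b)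
    (hf : Tendsto (fun q => f q * α q) atTop (𝓝 b)) (hα : Tendsto α atTop (𝓝 0))
    (hpos : ∀ᶠ q in atTop, 0 < α q) : Tendsto f atTop atTop := by
  have h1 : Tendsto α atTop (𝓝[>] 0) := tendsto_nhdsWithin_iff.2 ⟨hα, hpos⟩
  refine (hf.pos_mul_atTop hb (tendsto_inv_nhdsGT_zero.comp h1)).congr' ?_
  filter_upwards [hpos] with q hq
  simp only [Function.comp]
  rw [mul_assoc, mul_inv_cancel₀ hq.ne', mul_one]

/-- The normalizing exponents of the messages. -/
theorem scale_pos {ρ : ℝ} (hρ : 1 < ρ) {h : ℕ} (hh : 0 < h) (r : ℕ) :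
    ∀ᶠ q : ℕ in atTop, 0 < 1 / ρ ^ r * ((ρ ^ h - 1) / (ρ ^ (h * q) - 1)) := by
  filter_upwards [eventually_gt_atTop 0] with q hq
  have h1 : 0 < ρ ^ h - 1 := sub_pos.2 (one_lt_pow₀ hρ hh.ne')
  have h2 : 0 < ρ ^ (h * q) - 1 := sub_pos.2 (one_lt_pow₀ hρ (Nat.mul_pos hh hq).ne')
  positivity

theorem scale_tendsto_zero {ρ : ℝ} (hρ : 1 < ρ) {h : ℕ} (hh : 0 < h) (r : ℕ) :
    Tendsto (fun q : ℕ => 1 / ρ ^ r * ((ρ ^ h - 1) / (ρ ^ (h * q) - 1))) atTop (𝓝 0) := by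
  have h1 : Tendsto (fun q : ℕ => ρ ^ (h * q) - 1) atTop atTop :=
    tendsto_atTop_add_const_right _ (-1)
      ((tendsto_pow_atTop_atTop_of_one_lt hρ).comp (tendsto_id.const_mul_atTop' hh))
  simpa using (h1.const_div_atTop (ρ ^ h - 1)).const_mul (1 / ρ ^ r)

/-! ### The algorithm in logarithmic form -/

namespace BipGraph

variable {E L R : Type*} [Fintype E]

/-- The logarithm of the limiting product attached to the class `i`. -/
def logU (B : BipGraph E L R) {h : ℕ} (c : E → ZMod h) (ρ : ℝ) (Y : E → ℝ) (ω : L → ℝ)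
    (i : ZMod h) : ℝ :=
  ∑ j ∈ range h, ρ ^ j * classSum c Y (fun f => ω (B.lam f)) (i + j)

/-- Oddness in the log inputs reduces convergence to 0 to divergence to infinity for -ω. -/
theorem logU_neg {B : BipGraph E L R} {h : ℕ} (c : E → ZMod h) (ρ : ℝ) (Y : E → ℝ)
    (ω : L → ℝ) (i : ZMod h) :
    B.logU c ρ Y (-ω) i = -B.logU c ρ Y ω i := by
  simp [logU, classSum]

variable [DecidableEq E] [DecidableEq L]

/-- The logarithms of the bit-to-check messages as a function of the logarithms `ω` of the
inputs. -/
noncomputable def logMsg (B : BipGraph E L R) (ω : L → ℝ) (t : ℕ) (e : E) : ℝ :=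
  ∑ s ∈ range t, Matrix.mulVec (B.K ^ s) (fun f => ω (B.lam f)) e

/-- The logarithms of the estimates as a function of the logarithms `ω` of the inputs. -/
noncomputable def logEstimate (B : BipGraph E L R) (ω : L → ℝ) (t : ℕ) (l : L) : ℝ :=
  ω l + ∑ e ∈ univ.filter (fun e => B.lam e = l), B.logMsg ω t (B.conj e)

variable {B : BipGraph E L R}

theorem logMsg_neg (ω : L → ℝ) (t : ℕ) (e : E) : B.logMsg (-ω) t e = -B.logMsg ω t e := by
  rw [logMsg, logMsg, ← sum_neg_distrib]
  refine sum_congr rfl fun s _ => ?_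
  rw [← Pi.neg_apply, ← Matrix.mulVec_neg]
  rfl

theorem logEstimate_neg (ω : L → ℝ) (t : ℕ) (l : L) :
    B.logEstimate (-ω) t l = -B.logEstimate ω t l := by
  simp only [logEstimate, logMsg_neg, sum_neg_distrib, Pi.neg_apply]
  ring

theorem logMsg_succ (ω : L → ℝ) (t : ℕ) (e : E) :
    B.logMsg ω (t + 1) e = ω (B.lam e) + Matrix.mulVec B.K (B.logMsg ω t) e := by
  have h1 : B.logMsg ω t = ∑ s ∈ range t, Matrix.mulVec (B.K ^ s) (fun f => ω (B.lam f)) := by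
    ext f
    rw [logMsg, Finset.sum_apply]
  rw [h1, Matrix.mulVec_sum, Finset.sum_apply, logMsg, sum_range_succ', add_comm]
  congr 1
  · simp
  · refine sum_congr rfl fun s _ => ?_
    rw [pow_succ', Matrix.mulVec_mulVec]

theorem exp_logU [Fintype L] {ρ : ℝ} {h : ℕ} {cls : E → ℕ} {y₁ : E → ℝ} {u : L → ℝ}
    (hu : ∀ l, 0 < u l) (k : ℕ) :
    ∏ j ∈ range h, monomial u (cVec B ρ h cls y₁ (k + j)) ^ (ρ ^ j) =
      Real.exp (B.logU (fun e => (cls e : ZMod h)) ρ (yVec B.K ρ h cls y₁)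
        (fun l => Real.log (u l)) k) := by
  rw [logU, Real.exp_sum]
  refine prod_congr rfl fun j _ => ?_
  have h1 : monomial u (cVec B ρ h cls y₁ (k + j)) = Real.exp
      (∑ l, Real.log (u l) * cVec B ρ h cls y₁ (k + j) l) := by
    rw [monomial, Real.exp_sum]
    exact prod_congr rfl fun l _ => Real.rpow_def_of_pos (hu l) _
  rw [h1, ← Real.exp_mul, mul_comm]
  congr 2
  simp only [cVec, classSum, mul_sum, sum_filter, ← ZMod.natCast_eq_natCast_iff, Nat.cast_add]
  rw [sum_comm]
  refine sum_congr rfl fun e _ => ?_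
  split_ifs with he
  · rw [sum_eq_single (B.lam e)]
    · simp [Lam, mul_comm]
    · intro l _ hl
      simp [Lam, hl.symm]
    · simp
  · simp

section messages

variable [DecidableEq R]

/-- At a check node of degree two the inner product has a single factor, so this cancellation makes
the check step a mere relabelling by conjugation. -/
theorem sTransform_sTransform {x : ℝ} (hx : 0 < x) : sTransform (sTransform x) = x := by
  have h1 : 1 + x ≠ 0 := by linarith
  have h2 : 1 + (1 - x) / (1 + x) ≠ 0 := by
    have : 1 + (1 - x) / (1 + x) = 2 / (1 + x) := by field_simp; ring
    rw [this]
    positivity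
  rw [sTransform, sTransform, div_eq_iff h2]
  field_simp
  ring

theorem bitToCheck_exp (hcheck : ∀ c, B.checkDegree c = 2) {u : L → ℝ} (hu : ∀ l, 0 < u l)
    (v : E → ℝ) (e : E) : B.bitToCheck u (fun f => Real.exp (v (B.conj f))) e =
      Real.exp (Real.log (u (B.lam e)) + Matrix.mulVec B.K v e) := by
  rw [bitToCheck, mulVec_K hcheck, Real.exp_add, Real.exp_log (hu _), Real.exp_sum]

theorem yMsg_eq_exp (hcheck : ∀ c, B.checkDegree c = 2) {u : L → ℝ} (hu : ∀ l, 0 < u l) (t : ℕ) :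
    B.yMsg u t = fun e => Real.exp (B.logMsg (fun l => Real.log (u l)) t (B.conj e)) := by
  induction t with
  | zero => simp [yMsg, logMsg]
  | succ t ih =>
    ext e
    rw [yMsg, checkToBit, filter_rho hcheck, prod_singleton, ih, bitToCheck_exp hcheck hu,
      sTransform_sTransform (Real.exp_pos _), logMsg_succ]

theorem xMsg_eq_exp (hcheck : ∀ c, B.checkDegree c = 2) {u : L → ℝ} (hu : ∀ l, 0 < u l) (t : ℕ)
    (e : E) : B.xMsg u t e = Real.exp (B.logMsg (fun l => Real.log (u l)) t e) := by
  cases t with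
  | zero => simp [xMsg, logMsg]
  | succ t => rw [xMsg, yMsg_eq_exp hcheck hu, bitToCheck_exp hcheck hu, logMsg_succ]

theorem estimate_eq_exp (hcheck : ∀ c, B.checkDegree c = 2) {u : L → ℝ} (hu : ∀ l, 0 < u l)
    (t : ℕ) (l : L) :
    B.estimate u t l = Real.exp (B.logEstimate (fun l => Real.log (u l)) t l) := by
  rw [estimate, yMsg_eq_exp hcheck hu, logEstimate, Real.exp_add, Real.exp_log (hu l),
    Real.exp_sum]

end messages

/-! ### Growth of messages and estimates -/

section asymptotics

variable {h : ℕ} {c : E → ZMod h} {ρ : ℝ} {Y Z : E → ℝ} {M : ℕ}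

theorem tendsto_logMsg (H : IsCyclicPerron B.K c ρ Y Z) (hh : 0 < h) (hρ : 1 < ρ)
    (hM : ∀ e f, c f = c e → 0 < (B.K ^ M) e f) (ω : L → ℝ) (r : ℕ) (e : E) :
    Tendsto (fun q : ℕ => B.logMsg ω (h * q + r) e *
      (1 / ρ ^ r * ((ρ ^ h - 1) / (ρ ^ (h * q) - 1)))) atTop
      (𝓝 (Z e * B.logU c ρ Y ω (c e + r))) :=
  H.tendsto_sum_pow_mulVec hh hρ hM _ r e

theorem logMsg_tendsto_atTop (H : IsCyclicPerron B.K c ρ Y Z) (hh : 0 < h) (hρ : 1 < ρ)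
    (hM : ∀ e f, c f = c e → 0 < (B.K ^ M) e f) {ω : L → ℝ} (hω : ∀ i, 0 < B.logU c ρ Y ω i)
    (e : E) : Tendsto (fun t => B.logMsg ω t e) atTop atTop :=
  tendsto_of_residues hh fun r _ =>
    tendsto_atTop_of_scaled (mul_pos (H.right_pos e) (hω _)) (tendsto_logMsg H hh hρ hM ω r e)
      (scale_tendsto_zero hρ hh r) (scale_pos hρ hh r)

theorem logEstimate_tendsto_atTop (hbit : ∀ l, 2 ≤ B.bitDegree l) {ω : L → ℝ}
    (hω : ∀ e, Tendsto (fun t => B.logMsg ω t e) atTop atTop) (l : L) :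
    Tendsto (fun t => B.logEstimate ω t l) atTop atTop := by
  refine tendsto_atTop_add_const_left _ _ ?_
  have h1 : ∀ s : Finset E, s.Nonempty →
      Tendsto (fun t => ∑ e ∈ s, B.logMsg ω t (B.conj e)) atTop atTop := by
    intro s hs
    induction hs using Finset.Nonempty.cons_induction with
    | singleton a => simpa using hω (B.conj a)
    | cons a s ha _ ih =>
      simp only [sum_cons]
      exact (hω _).atTop_add_atTop ih
  exact h1 _ (card_pos.1 (lt_of_lt_of_le (by norm_num) (hbit l)))

/-- The `Y`-weighted sum of the logarithmic messages over a class is known exactly after whole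
periods. -/
theorem classSum_logMsg (H : IsCyclicPerron B.K c ρ Y Z) (hh : 0 < h) (hρ : 1 < ρ) (ω : L → ℝ)
    (q : ℕ) (i : ZMod h) : classSum c Y (B.logMsg ω (h * q)) i =
      (ρ ^ (h * q) - 1) / (ρ ^ h - 1) * B.logU c ρ Y ω i := by
  rw [logU, ← sum_range_periodic_geom hρ hh]
  rw [sum_congr rfl fun s _ => (H.classSum_pow_mulVec (fun f => ω (B.lam f)) s i).symm]
  simp only [classSum, logMsg, mul_sum]
  exact sum_comm

/-- The exact identity for class sums is evaluated at one large time. Passing to the limit would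
give only a weak inequality and would not exclude the value 0. -/
theorem logU_pos_of_logMsg (H : IsCyclicPerron B.K c ρ Y Z) (hh : 0 < h) (hρ : 1 < ρ) {ω : L → ℝ}
    (hω : ∀ e, Tendsto (fun t => B.logMsg ω t e) atTop atTop) (i : ZMod h) :
    0 < B.logU c ρ Y ω i := by
  have h1 : ∀ᶠ t in atTop, ∀ e, 0 < B.logMsg ω t e :=
    eventually_all.2 fun e => (hω e).eventually_gt_atTop 0
  have hq : Tendsto (fun q : ℕ => h * q) atTop atTop := tendsto_id.const_mul_atTop' hh
  obtain ⟨q, hq1, hq2⟩ := ((hq.eventually h1).and (eventually_gt_atTop 0)).exists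
  have h2 := classSum_logMsg H hh hρ ω q i
  have hne : ({e | c e = i} : Finset E).Nonempty := by
    refine nonempty_of_sum_ne_zero (f := fun e => Y e * Z e) ?_
    rw [H.normalized]
    norm_num
  have h3 : 0 < classSum c Y (B.logMsg ω (h * q)) i :=
    sum_pos (fun e _ => mul_pos (H.left_pos e) (hq1 e)) hne
  rw [h2] at h3
  have h4 : 0 < ρ ^ h - 1 := sub_pos.2 (one_lt_pow₀ hρ hh.ne')
  have h5 : 0 < ρ ^ (h * q) - 1 := sub_pos.2 (one_lt_pow₀ hρ (Nat.mul_pos hh hq2).ne')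
  exact pos_of_mul_pos_right h3 (by positivity)

/-- At a bit node of degree at least three, the conjugates of all the edges are in the same
class. -/
theorem exists_class_conj [DecidableEq R] (H : IsCyclicPerron B.K c ρ Y Z)
    (hcheck : ∀ c, B.checkDegree c = 2) {l : L} (hl : 3 ≤ B.bitDegree l) :
    ∃ k, ∀ e, B.lam e = l → c (B.conj e) = k := by
  have hstep : ∀ {e f : E}, B.lam e = l → B.lam f = l → e ≠ f → c (B.conj e) = c f + 1 := by
    intro e f he hf hef
    exact H.cyclic _ _ (K_ne_zero.2 (by rw [conj_conj hcheck]; exact ⟨he.trans hf.symm, hef⟩))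
  have hpair : ∀ e f : E, B.lam e = l → B.lam f = l → c (B.conj e) = c (B.conj f) := by
    intro e f he hf
    -- The conjugates of e and f both flow into a third edge g, which determines their class.
    have h1 : (({e | B.lam e = l} : Finset E) \ {e, f}).Nonempty := by
      rw [← card_pos]
      have h2 := le_card_sdiff ({e, f} : Finset E) {e | B.lam e = l}
      have h3 : ({e, f} : Finset E).card ≤ 2 := card_le_two
      rw [bitDegree] at hl
      omega
    obtain ⟨g, hg⟩ := h1
    rw [Finset.mem_sdiff, mem_filter, mem_insert, mem_singleton, not_or] at hg
    rw [hstep he hg.1.2 (Ne.symm hg.2.1), hstep hf hg.1.2 (Ne.symm hg.2.2)]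
  obtain ⟨e₀, he₀⟩ := card_pos.1 (lt_of_lt_of_le (by norm_num) hl : 0 < B.bitDegree l)
  exact ⟨c (B.conj e₀), fun e he => hpair e e₀ he (by simpa using he₀)⟩

/-- At a node of degree at least three all terms of the estimate grow with the same `logU`, so no
cancellation between classes can hide its sign. Taking the limit loses strictness, so the value 0 is
not excluded here. -/
theorem logU_nonneg_of_logEstimate [DecidableEq R] (H : IsCyclicPerron B.K c ρ Y Z) (hh : 0 < h)
    (hρ : 1 < ρ) (hM : ∀ e f, c f = c e → 0 < (B.K ^ M) e f)
    (hcheck : ∀ c, B.checkDegree c = 2) {l : L} (hl : 3 ≤ B.bitDegree l) {ω : L → ℝ}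
    (hω : Tendsto (fun t => B.logEstimate ω t l) atTop atTop) (i : ZMod h) :
    0 ≤ B.logU c ρ Y ω i := by
  have : NeZero h := ⟨hh.ne'⟩
  obtain ⟨k, hk⟩ := exists_class_conj H hcheck hl
  -- The residue of the time for which messages in class k see the index k + r = i.
  set r := (i - k).val with hr
  set α : ℕ → ℝ := fun q => 1 / ρ ^ r * ((ρ ^ h - 1) / (ρ ^ (h * q) - 1)) with hα
  set S : Finset E := univ.filter fun e => B.lam e = l with hS
  have h1 : Tendsto (fun q => B.logEstimate ω (h * q + r) l * α q) atTop
      (𝓝 ((∑ e ∈ S, Z (B.conj e)) * B.logU c ρ Y ω i)) := by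
    have h2 : Tendsto (fun q => ω l * α q + ∑ e ∈ S, B.logMsg ω (h * q + r) (B.conj e) * α q) atTop
        (𝓝 (ω l * 0 + ∑ e ∈ S, Z (B.conj e) * B.logU c ρ Y ω (c (B.conj e) + r))) :=
      ((scale_tendsto_zero hρ hh r).const_mul _).add
        (tendsto_finsetSum _ fun e _ => tendsto_logMsg H hh hρ hM ω r _)
    have h3 : ∑ e ∈ S, Z (B.conj e) * B.logU c ρ Y ω (c (B.conj e) + r) =
        (∑ e ∈ S, Z (B.conj e)) * B.logU c ρ Y ω i := by
      rw [sum_mul]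
      refine sum_congr rfl fun e he => ?_
      rw [hk e (mem_filter.1 he).2, hr, ZMod.natCast_zmod_val, add_sub_cancel]
    rw [h3, mul_zero, zero_add] at h2
    refine h2.congr fun q => ?_
    rw [logEstimate, add_mul, sum_mul]
  have h2 : Tendsto (fun q : ℕ => h * q + r) atTop atTop :=
    (tendsto_add_atTop_nat r).comp (tendsto_id.const_mul_atTop' hh)
  have h3 : 0 ≤ (∑ e ∈ S, Z (B.conj e)) * B.logU c ρ Y ω i := by
    refine ge_of_tendsto h1 ?_
    filter_upwards [h2.eventually (hω.eventually_gt_atTop 0), scale_pos hρ hh r] with q hq1 hq2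
    exact (mul_pos hq1 hq2).le
  have h4 : 0 < ∑ e ∈ S, Z (B.conj e) :=
    sum_pos (fun e _ => H.right_pos _) (card_pos.1 (lt_of_lt_of_le (by norm_num) hl))
  exact nonneg_of_mul_nonneg_right h3 h4

/-- Summing the entries of YK = ρY weights each Y_e by its bit degree minus one, which is at least 1
everywhere and at least 2 somewhere. -/
theorem one_lt_root [DecidableEq R] (H : IsCyclicPerron B.K c ρ Y Z)
    (hcheck : ∀ c, B.checkDegree c = 2) (hbit : ∀ l, 2 ≤ B.bitDegree l)
    (hbit3 : ∃ l, 3 ≤ B.bitDegree l) : 1 < ρ := by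
  obtain ⟨l, hl⟩ := hbit3
  obtain ⟨e₀, he₀⟩ := card_pos.1 (lt_of_lt_of_le (by norm_num) hl : 0 < B.bitDegree l)
  have he₀ : B.lam e₀ = l := by simpa using he₀
  have h1 : ρ * ∑ e, Y e = ∑ e, Y e * (B.bitDegree (B.lam e) - 1) := by
    simp only [← sum_K_row hcheck, mul_sum]
    rw [sum_comm]
    exact sum_congr rfl fun f _ => (congrFun H.left_eigen f).symm
  have h2 : ∑ e, Y e < ∑ e, Y e * ((B.bitDegree (B.lam e) : ℝ) - 1) := by
    refine sum_lt_sum (fun e _ => ?_) ⟨e₀, mem_univ _, ?_⟩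
    · have : (2 : ℝ) ≤ B.bitDegree (B.lam e) := by exact_mod_cast hbit _
      exact le_mul_of_one_le_right (H.left_pos e).le (by linarith)
    · have : (3 : ℝ) ≤ B.bitDegree (B.lam e₀) := by rw [he₀]; exact_mod_cast hl
      exact lt_mul_of_one_lt_right (H.left_pos e₀) (by linarith)
  rw [← h1] at h2
  have h3 : 0 < ∑ e, Y e := sum_pos (fun e _ => H.left_pos e) ⟨e₀, mem_univ _⟩
  exact (lt_mul_iff_one_lt_left h3).1 h2

end asymptotics

end BipGraph
end SPA

/-! ### The theorem -/

open SPA SPA.BipGraph in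
theorem theorem4p3 {E L R : Type*} [Fintype E] [DecidableEq E] [Fintype L] [DecidableEq L]
    [Fintype R] [DecidableEq R] (B : SPA.BipGraph E L R)
    (hconn : B.toDirGraph.symm.Connected)
    (hcheck : ∀ c : R, B.checkDegree c = 2)
    (hbit : ∀ l : L, 2 ≤ B.bitDegree l)
    (hbit3 : ∃ l : L, 3 ≤ B.bitDegree l)
    (ρ : ℝ) (hρ : SPA.IsPerronRoot B.K ρ)
    (h : ℕ) (hh : B.IsImprimitivityIndex h)
    (cls : E → ℕ) (hcls : B.IsCyclicPartition h cls)
    (y₁ z₁ : E → ℝ) (hyz : SPA.IsPerronPair B.K ρ h cls y₁ z₁)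
    (u : L → ℝ) (hu : ∀ l, 0 < u l) :
    (∀ r < h, ∀ i : ℕ, ∀ e : E, cls e = i →
      Tendsto
        (fun q : ℕ => B.xMsg u (h * q + r) e ^ (1 / ρ ^ r * ((ρ ^ h - 1) / (ρ ^ (h * q) - 1))))
        atTop
        (𝓝 ((∏ j ∈ range h, SPA.monomial u (SPA.cVec B ρ h cls y₁ (r + i + j)) ^ (ρ ^ j)) ^
          SPA.zVec B.K ρ h cls z₁ e))) ∧
    (B.Converges u ↔ SPA.SameParity h (SPA.U B ρ h cls y₁ u)) ∧
    ((∀ r < h, SPA.U B ρ h cls y₁ u r ≠ 1) →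
      (B.EstimatesConverge u ↔ SPA.SameParity h (SPA.U B ρ h cls y₁ u))) := by
  have hirr := flowsTo_all hconn hcheck hbit hbit3
  have hc : ∀ e f, B.K e f ≠ 0 → (cls f : ZMod h) = cls e + 1 := fun _ _ => K_class hcheck hcls
  have H := hyz.isCyclicPerron K_nonneg (fun e f => hirr f e) hc hcls.1 hρ.1
  have hρ1 := one_lt_root H hcheck hbit hbit3
  obtain ⟨e₁, -⟩ := hyz.exists_class_one
  have hh0 : 0 < h := (hcls.1 e₁).1.trans (hcls.1 e₁).2
  have : NeZero h := ⟨hh0.ne'⟩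
  obtain ⟨M, hM⟩ := exists_pow_pos hcheck hh hcls hirr <| by
    -- If K were zero, the eigenvector equation would make ρ Z vanish, although both factors are
    -- positive.
    by_contra! h0
    have h1 := congrFun H.right_eigen e₁
    have h2 : 0 < ρ * zVec B.K ρ h cls z₁ e₁ := mul_pos H.root_pos (H.right_pos e₁)
    simp [Matrix.mulVec, dotProduct, h0] at h1
    rcases h1 with h1 | h1 <;> simp [h1] at h2
  set c : E → ZMod h := fun e => (cls e : ZMod h) with hcdef
  set Y := yVec B.K ρ h cls y₁
  set Z := zVec B.K ρ h cls z₁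
  set ω : L → ℝ := fun l => Real.log (u l) with hω
  have hU : ∀ r : ℕ, U B ρ h cls y₁ u r = Real.exp (B.logU c ρ Y ω r) := fun r => exp_logU hu r
  -- The representatives r < h exhaust the residues modulo h, so conditions on the U_r become
  -- conditions on `logU` at every class.
  have hforall : ∀ P : ℝ → Prop, (∀ r < h, P (U B ρ h cls y₁ u r)) ↔
      ∀ i, P (Real.exp (B.logU c ρ Y ω i)) := by
    intro P
    refine ⟨fun hP i => ?_, fun hP r _ => hU r ▸ hP r⟩
    have h1 := hP i.val (ZMod.val_lt i)
    rwa [hU, ZMod.natCast_zmod_val] at h1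
  have hparity : SameParity h (U B ρ h cls y₁ u) ↔
      (∀ i, 0 < B.logU c ρ Y (-ω) i) ∨ ∀ i, 0 < B.logU c ρ Y ω i := by
    rw [SameParity, hforall (· < 1), hforall (1 < ·)]
    simp only [Real.exp_lt_one_iff, Real.one_lt_exp_iff, logU_neg, Left.neg_pos_iff]
  have hmsg0 : ∀ e, Tendsto (fun t => B.xMsg u t e) atTop (𝓝 0) ↔
      Tendsto (fun t => B.logMsg (-ω) t e) atTop atTop := fun e => by
    simp only [xMsg_eq_exp hcheck hu, Real.tendsto_exp_comp_nhds_zero, logMsg_neg,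
      tendsto_neg_atTop_iff, hω]
  have hmsg1 : ∀ e, Tendsto (fun t => B.xMsg u t e) atTop atTop ↔
      Tendsto (fun t => B.logMsg ω t e) atTop atTop := fun e => by
    simp only [xMsg_eq_exp hcheck hu, Real.tendsto_exp_comp_atTop, hω]
  have hest0 : ∀ l, Tendsto (fun t => B.estimate u t l) atTop (𝓝 0) ↔
      Tendsto (fun t => B.logEstimate (-ω) t l) atTop atTop := fun l => by
    simp only [estimate_eq_exp hcheck hu, Real.tendsto_exp_comp_nhds_zero, logEstimate_neg,
      tendsto_neg_atTop_iff, hω]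
  have hest1 : ∀ l, Tendsto (fun t => B.estimate u t l) atTop atTop ↔
      Tendsto (fun t => B.logEstimate ω t l) atTop atTop := fun l => by
    simp only [estimate_eq_exp hcheck hu, Real.tendsto_exp_comp_atTop, hω]
  have hto : ∀ ω' : L → ℝ, (∀ i, 0 < B.logU c ρ Y ω' i) →
      (∀ e, Tendsto (fun t => B.logMsg ω' t e) atTop atTop) ∧
        ∀ l, Tendsto (fun t => B.logEstimate ω' t l) atTop atTop := fun ω' hω' =>
    have h1 := logMsg_tendsto_atTop H hh0 hρ1 hM hω'
    ⟨h1, logEstimate_tendsto_atTop hbit h1⟩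
  refine ⟨?_, ?_, ?_⟩
  · rintro r - i e rfl
    rw [exp_logU hu, ← Real.exp_mul]
    simp only [xMsg_eq_exp hcheck hu, ← Real.exp_mul]
    have h1 := tendsto_logMsg H hh0 hρ1 hM ω r e
    rw [mul_comm, show c e + r = ((r + cls e : ℕ) : ZMod h) by push_cast; rw [add_comm]] at h1
    exact (Real.continuous_exp.tendsto _).comp h1
  · rw [hparity, Converges, ConvergesToZero, ConvergesToInfty]
    simp only [hmsg0, hmsg1, hest0, hest1]
    exact or_congr ⟨fun h1 => logU_pos_of_logMsg H hh0 hρ1 h1.1, hto _⟩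
      ⟨fun h1 => logU_pos_of_logMsg H hh0 hρ1 h1.1, hto _⟩
  · intro hne
    rw [hforall (· ≠ 1)] at hne
    simp only [ne_eq, Real.exp_eq_one_iff] at hne
    rw [hparity, EstimatesConverge]
    simp only [hest0, hest1]
    obtain ⟨l, hl⟩ := hbit3
    refine or_congr ⟨fun h1 i => ?_, fun h1 => (hto _ h1).2⟩
      ⟨fun h1 i => ?_, fun h1 => (hto _ h1).2⟩
    · refine (logU_nonneg_of_logEstimate H hh0 hρ1 hM hcheck hl (h1 l) i).lt_of_ne' ?_
      rw [logU_neg, neg_ne_zero]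
      exact hne i
    · exact (logU_nonneg_of_logEstimate H hh0 hρ1 hM hcheck hl (h1 l) i).lt_of_ne' (hne i)
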